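/- Let $p$ be a prime. For an $F$-finite Noetherian local ring $(R,\mathfrak m)$ of characteristic $p$ with residue field $\kappa(\mathfrak m)$, let $a_e(R)$ be the largest $n$ such that $R^n$ is a direct summand of the $R$-module $F^e_*R$, and let $s(R)=\lim_{e\to\infty} a_e(R)/p^{e\delta}$ with $p^{\delta}=p^{\dim R}\,[\kappa(\mathfrak m)^{1/p}:\kappa(\mathfrak m)]$ be the $F$-signature of $R$. Such a ring is strongly $F$-regular if for every $c$ in no minimal prime of $R$ there is $e>0$ such that the $R$-linear map $R\to F^e_*R$, $1\mapsto F^e_*c$, splits. (1) Let $(A,\mathfrak a)\subset(B,\mathfrak b)$ be a finite local extension of $F$-finite Noetherian local rings of characteristic $p$ such that $B$ is a reflexive $A$-module. Suppose there is $T\in\operatorname{Hom}_A(B,A)$ that freely generates $\operatorname{Hom}_A(B,A)$ as a $B$-module, is surjective, and satisfies $T(\mathfrak b)\subset\mathfrak a$. Then the limits $s(A)$ and $s(B)$ exist. If $A$ is not a domain, then $s(A)=0=s(B)$. If $A$ is a domain with fraction field $E$ and $B_E=E\otimes_AB$, then $$[\kappa(\mathfrak b):\kappa(\mathfrak a)]\cdot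 s(B)=\dim_E B_E\cdot s(A).$$ Moreover $B$ is strongly $F$-regular if and only if $A$ is, and $B$ is a strongly $F$-regular domain if and only if $A$ is. (2) Let $k$ be a field of characteristic $p$, let $(S,\mathfrak n)$ be an $F$-finite Noetherian local $k$-algebra satisfying Serre's condition $\mathbf S_2$, and let $G$ be a finite group-scheme over $k$ of order $o(G)=\dim_k\mathcal O(G)$ acting on $\operatorname{Spec} S$ through a coaction $\alpha\colon S\to S\otimes_k\mathcal O(G)$. Assume that the ring of invariants $(R,\mathfrak m)=\{s\in S:\alpha(s)=s\otimes1\}$ is a Noetherian local ring satisfying $\mathbf S_2$, that $R\subset S$ is a finite local extension, and that it is a $G$-torsor in codimension $1$: for every prime $P$ of $R$ of height one, and for $P=\mathfrak m$ if $\dim R=0$, $S_P$ is faithfully flat over $R_P$ and the map $S\otimes_RS\to S\otimes_k\mathcal O(G)$, $a\otimes b\mapsto(a\otimes1)\alpha(b)$, becomes an isomorphism after localization at $P$. Let $\operatorname{Tr}_{S/R}\colon S\to R$, $s\mapsto(\mathrm{id}\otimes t)(\alpha(s))$, be the trace attached to a nonzero left integral $t$ of the dual Hopf algebra $\mathcal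 O(G)^\vee$. If $\operatorname{Tr}_{S/R}$ is surjective and $\operatorname{Tr}_{S/R}(\mathfrak n)\subset\mathfrak m$, then the limits $s(R)$ and $s(S)$ exist and $$[\kappa(\mathfrak n):\kappa(\mathfrak m)]\cdot s(S)=o(G)\cdot s(R).$$ -/

import Mathlib

open scoped TensorProduct
open IsLocalRing

universe u v w

/-! ### Frobenius pushforward -/

/-- The Frobenius pushforward `F^e_* M`: the same additive group as `M`, on which `r` acts as
multiplication by `r ^ (p ^ e)`. -/
def FrobPush (_p _e : ℕ) (M : Type u) : Type u := M

namespace FrobPush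

variable {p e : ℕ} {M : Type u}

instance [AddCommGroup M] : AddCommGroup (FrobPush p e M) := inferInstanceAs (AddCommGroup M)

/-- The element `F^e_* m` of `F^e_* M`. -/
def of (p e : ℕ) [AddCommGroup M] : M ≃+ FrobPush p e M := AddEquiv.refl M

variable {R : Type v} [CommRing R] [ExpChar R p] [AddCommGroup M] [Module R M]

instance : Module R (FrobPush p e M) := Module.compHom M (iterateFrobenius R p e)

theorem smul_of (r : R) (m : M) : r • of p e m = of p e (r ^ p ^ e • m) := rfl

end FrobPush

/-- A ring of characteristic `p` is `F`-finite if Frobenius is a finite ring homomorphism. -/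
def IsFFinite (p : ℕ) (R : Type u) [CommRing R] [ExpChar R p] : Prop :=
  (frobenius R p).Finite

/-! ### `F`-signature and strong `F`-regularity -/

/-- The free rank of an `R`-module `M`: the largest `n` such that `R ^ n` is (isomorphic to) a
direct summand of `M`. (For `M` finitely generated over a nontrivial ring such `n` are bounded.) -/
noncomputable def freeRank (R : Type u) [CommRing R] (M : Type v) [AddCommGroup M] [Module R M] :
    ℕ :=
  sSup {n : ℕ | ∃ (i : (Fin n → R) →ₗ[R] M) (q : M →ₗ[R] (Fin n → R)), q ∘ₗ i = LinearMap.id}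

instance residueField_charP (p : ℕ) [Fact p.Prime] (R : Type u) [CommRing R] [IsLocalRing R]
    [CharP R p] : CharP (ResidueField R) p :=
  (CharP.charP_iff_prime_eq_zero Fact.out).mpr <| by
    rw [← map_natCast (residue R), CharP.cast_eq_zero, map_zero]

/-- The Krull dimension as a natural number (it is finite for a Noetherian local ring). -/
noncomputable def dimNat (R : Type u) [CommRing R] : ℕ := ((ringKrullDim R).unbotD 0).toNat

section FSignature

variable (p : ℕ) [Fact p.Prime] (R : Type u) [CommRing R] [IsLocalRing R] [CharP R p]

/-- `[κ ^ (1/p) : κ]` for the residue field `κ` of `R`, that is `dim_κ F_* κ`. -/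
noncomputable def residueFrobDegree : ℕ :=
  Module.finrank (ResidueField R) (FrobPush p 1 (ResidueField R))

/-- The normalized `F`-splitting numbers `a_e / p ^ (e δ)`, where `a_e` is the free rank of
`F^e_* R` and `p ^ δ = p ^ (dim R) * [κ ^ (1/p) : κ]`. -/
noncomputable def fSplittingRatio (e : ℕ) : ℝ :=
  (freeRank R (FrobPush p e R) : ℝ) / ((p : ℝ) ^ dimNat R * residueFrobDegree p R) ^ e

/-- The `F`-signature `s(R) = lim a_e / p ^ (e δ)`. -/
noncomputable def fSignature : ℝ := Filter.limUnder Filter.atTop (fSplittingRatio p R)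

/-- The limit that defines the `F`-signature exists. -/
def FSignatureExists : Prop :=
  Filter.Tendsto (fSplittingRatio p R) Filter.atTop (nhds (fSignature p R))

end FSignature

/-- Strong `F`-regularity of an `F`-finite ring: for each `c` in no minimal prime there is `e > 0`
such that `R → F^e_* R`, `1 ↦ F^e_* c`, splits. -/
def IsStronglyFRegular (p : ℕ) (R : Type u) [CommRing R] [ExpChar R p] : Prop :=
  ∀ c : R, (∀ P ∈ minimalPrimes R, c ∉ P) →
    ∃ e : ℕ, 0 < e ∧ ∃ φ : FrobPush p e R →ₗ[R] R, φ (FrobPush.of p e c) = 1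

/-! ### Generators of the dual -/

/-- `T` freely generates `Hom_A(B, A)` as a `B`-module, where `(b • T) x = T (b * x)`. -/
def FreelyGeneratesDual {A : Type u} {B : Type v} [CommRing A] [CommRing B] [Algebra A B]
    (T : B →ₗ[A] A) : Prop :=
  Function.Bijective fun b : B => T ∘ₗ LinearMap.mulLeft A b

/-! ### Serre's condition `S₂` -/

/-- The local ring `R` has depth at least `n`. -/
def DepthGE (R : Type u) [CommRing R] [IsLocalRing R] (n : ℕ) : Prop :=
  ∃ rs : List R, (∀ r ∈ rs, r ∈ maximalIdeal R) ∧ rs.length = n ∧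
    RingTheory.Sequence.IsRegular R rs

/-- Serre's condition `S₂`: `depth R_P ≥ min (2, dim R_P)` for all primes `P`. -/
def IsSerreS2 (R : Type u) [CommRing R] : Prop :=
  ∀ (P : Ideal R) [P.IsPrime] (n : ℕ), n ≤ 2 → (n : ℕ∞) ≤ P.height →
    DepthGE (Localization.AtPrime P) n

/-! ### Actions of finite group-schemes

An affine group-scheme `G` over `k` is given by its commutative Hopf algebra `H = 𝒪(G)`. -/

/-- A right action of `G` on `Spec S`, i.e. a right coaction of `H = 𝒪(G)` on the `k`-algebra `S`. -/
structure GroupSchemeAction (k : Type u) (S : Type v) (H : Type w) [Field k] [CommRing S]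
    [Algebra k S] [CommRing H] [HopfAlgebra k H] where
  /-- the coaction -/
  coact : S →ₐ[k] S ⊗[k] H
  coassoc : ∀ s : S, TensorProduct.assoc k S H H (coact.toLinearMap.rTensor H (coact s)) =
    (Coalgebra.comul (R := k) (A := H)).lTensor S (coact s)
  counit : ∀ s : S,
    TensorProduct.rid k S ((Coalgebra.counit (R := k) (A := H)).lTensor S (coact s)) = s

/-- Left integrals of the dual Hopf algebra `𝒪(G)^∨`: forms `t` with `g * t = g(1) t` for all
`g ∈ 𝒪(G)^∨`, the product being `(g * t)(h) = (g ⊗ t)(Δ h)`. -/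
def IsLeftIntegral {k : Type u} {H : Type w} [Field k] [CommRing H] [HopfAlgebra k H]
    (t : H →ₗ[k] k) : Prop :=
  ∀ (g : H →ₗ[k] k) (h : H),
    LinearMap.mul' k k (TensorProduct.map g t (Coalgebra.comul h)) = g 1 * t h

theorem IsLeftIntegral.lTensor_comul {k : Type u} {H : Type w} [Field k] [CommRing H]
    [HopfAlgebra k H] {t : H →ₗ[k] k} (ht : IsLeftIntegral t) (h : H) :
    TensorProduct.rid k H (t.lTensor H (Coalgebra.comul h)) = t h • (1 : H) := by
  refine Module.forall_dual_apply_eq_zero_iff k _ |>.mp ?_ |> sub_eq_zero.mp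
  intro g
  have key : ∀ x : H ⊗[k] H, g (TensorProduct.rid k H (t.lTensor H x)) =
      LinearMap.mul' k k (TensorProduct.map g t x) := by
    intro x
    induction x with
    | zero => simp
    | tmul a b => simp [mul_comm]
    | add x y hx hy => simp only [map_add, hx, hy]
  rw [map_sub, key, ht g h, map_smul, smul_eq_mul, mul_comm, sub_self]

namespace GroupSchemeAction

variable {k : Type u} {S : Type v} {H : Type w} [Field k] [CommRing S] [Algebra k S] [CommRing H]
  [HopfAlgebra k H] (α : GroupSchemeAction k S H)

/-- The ring of invariants `S^G = {s | α(s) = s ⊗ 1}`. -/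
def invariants : Subalgebra k S :=
  AlgHom.equalizer α.coact Algebra.TensorProduct.includeLeft

theorem mem_invariants {s : S} : s ∈ α.invariants ↔ α.coact s = s ⊗ₜ 1 := Iff.rfl

instance (p : ℕ) [CharP S p] : CharP α.invariants p :=
  RingHom.charP α.invariants.val.toRingHom Subtype.val_injective p

/-- The coaction is linear over the ring of invariants. -/
def coactInv : S →ₐ[α.invariants] S ⊗[k] H :=
  { α.coact.toRingHom with
    commutes' := fun r => r.2 }

/-- The canonical map `S ⊗_R S → S ⊗_k 𝒪(G)`, `a ⊗ b ↦ (a ⊗ 1) α(b)`, over `R = S^G`. -/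
noncomputable def canonicalMap : S ⊗[α.invariants] S →ₐ[α.invariants] S ⊗[k] H :=
  Algebra.TensorProduct.lift (Algebra.TensorProduct.includeLeft : S →ₐ[α.invariants] S ⊗[k] H)
    α.coactInv fun _ _ => Commute.all _ _

/-- `R = S^G ⊂ S` is a `G`-torsor at the prime `P` of `R`: `S_P` is faithfully flat over `R_P`, and
the canonical map of `S_P` over `R_P` (i.e. the localization at `P` of the canonical map of `S` over
`R`) is an isomorphism. -/
def IsTorsorAt (P : Ideal α.invariants) [P.IsPrime] : Prop :=
  Module.FaithfullyFlat (Localization.AtPrime P) (LocalizedModule P.primeCompl S) ∧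
    Function.Bijective (LocalizedModule.map P.primeCompl α.canonicalMap.toLinearMap)

/-- `R = S^G ⊂ S` is a `G`-torsor in codimension one: it is so at all primes of height one (and at
all primes if `R` has dimension zero, so has no primes of height one). -/
def IsTorsorInCodimOne : Prop :=
  ∀ (P : Ideal α.invariants) [P.IsPrime], P.height = 1 ∨ ringKrullDim α.invariants = 0 →
    α.IsTorsorAt P

/-- The map `s ↦ (id ⊗ t)(α(s))` from `S` to itself. -/
noncomputable def preTrace (t : H →ₗ[k] k) : S →ₗ[k] S :=
  (TensorProduct.rid k S).toLinearMap ∘ₗ t.lTensor S ∘ₗ α.coact.toLinearMap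

theorem preTrace_mem {t : H →ₗ[k] k} (ht : IsLeftIntegral t) (s : S) :
    α.preTrace t s ∈ α.invariants := by
  rw [mem_invariants]
  have h1 : ∀ x : S ⊗[k] H, α.coact (TensorProduct.rid k S (t.lTensor S x)) =
      ((TensorProduct.rid k H).toLinearMap ∘ₗ t.lTensor H).lTensor S
        (TensorProduct.assoc k S H H (α.coact.toLinearMap.rTensor H x)) := by
    intro x
    induction x with
    | zero => simp
    | add x y hx hy => simp only [map_add, hx, hy]
    | tmul a b =>
      simp only [LinearMap.lTensor_tmul, LinearMap.rTensor_tmul, TensorProduct.rid_tmul, map_smul,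
        AlgHom.toLinearMap_apply]
      generalize α.coact a = y
      induction y with
      | zero => simp
      | add x y hx hy => simp only [map_add, smul_add, TensorProduct.add_tmul, hx, hy]
      | tmul c d => simp
  have h2 : ∀ x : S ⊗[k] H, ((TensorProduct.rid k H).toLinearMap ∘ₗ t.lTensor H).lTensor S
      ((Coalgebra.comul (R := k) (A := H)).lTensor S x) =
      (TensorProduct.rid k S (t.lTensor S x)) ⊗ₜ (1 : H) := by
    intro x
    induction x with
    | zero => simp
    | add x y hx hy => simp only [map_add, TensorProduct.add_tmul, hx, hy]
    | tmul a b =>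
      simp only [LinearMap.lTensor_tmul, LinearMap.comp_apply, LinearEquiv.coe_coe,
        TensorProduct.rid_tmul, ht.lTensor_comul, TensorProduct.tmul_smul, TensorProduct.smul_tmul']
  change α.coact (TensorProduct.rid k S (t.lTensor S (α.coact s))) =
    (TensorProduct.rid k S (t.lTensor S (α.coact s))) ⊗ₜ (1 : H)
  rw [h1, α.coassoc, h2]

theorem preTrace_mul (t : H →ₗ[k] k) (r : α.invariants) (s : S) :
    α.preTrace t (r * s) = r * α.preTrace t s := by
  have h : ∀ x : S ⊗[k] H, TensorProduct.rid k S (t.lTensor S (((r : S) ⊗ₜ (1 : H)) * x)) =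
      r * TensorProduct.rid k S (t.lTensor S x) := by
    intro x
    induction x with
    | zero => simp
    | add x y hx hy => simp only [map_add, mul_add, hx, hy]
    | tmul a b => simp
  change TensorProduct.rid k S (t.lTensor S (α.coact (r * s))) =
    r * TensorProduct.rid k S (t.lTensor S (α.coact s))
  rw [map_mul, α.mem_invariants.mp r.2, h]

/-- The trace `Tr_{S/R} : S → R = S^G`, `s ↦ (id ⊗ t)(α(s))`, attached to a left integral `t` of
`𝒪(G)^∨`. -/
noncomputable def trace (t : H →ₗ[k] k) (ht : IsLeftIntegral t) : S →ₗ[α.invariants] α.invariants where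
  toFun s := ⟨α.preTrace t s, α.preTrace_mem ht s⟩
  map_add' a b := Subtype.ext (map_add _ a b)
  map_smul' r s := Subtype.ext (α.preTrace_mul t r s)

end GroupSchemeAction

/-!
Everything rests on a description of the free rank. Over a local ring `(A, 𝔪)` the elements of a
finite module `N` that all forms `N → A` send into `𝔪` make up a submodule `nonSplit A N`, and the
free rank of `N` is the length of `N / nonSplit A N` (`freeRank_eq_length`). So along a map
`M → N` the free rank grows by at most the number of generators of the cokernel
(`freeRank_le_add_length`).

*Existence of the limits.* If `c M = 0` for a nonzerodivisor `c`, then `F^e_* M` has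
`O(p ^ (e δ) / p ^ e)` generators, because `dim A / c < dim A`
(`exists_frobPush_generators_le_of_smul_eq_zero`). Over a domain, `M` and a free module of the same
rank `r` map to each other with cokernels killed by nonzero elements, so the splitting numbers of
`F^e_* M` differ from `r` times those of `F^e_* A` by `O(p ^ (e δ) / p ^ e)`
(`abs_splittingRatio_sub_le`). For `M = F_* A` this is a recursion `s (e + 1) = t s e + O(p ^ (-e))`
for the normalized splitting numbers `s e`, which are bounded, and hence converge whatever `t` is
(`exists_tendsto_of_abs_sub_le`). For general `M` the limit is `r` times the `F`-signature
(`tendsto_splittingRatio_of_isDomain`). If `A` is not a domain, either it has a nonzero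
nilpotent element, and then `F^e_* M` has no free summand for large `e`, or some nonzerodivisor `c`
is such that `F^e_* (c M)` lies in `nonSplit` for all `e`
(`exists_nonZeroDivisor_not_split`); in both cases the limits are zero. A
surjective form `B → A` bounds free ranks over `B` by those over `A`, so `s(B)` vanishes as well.

*The transformation rule.* If `T` generates `Hom_A(B, A)`, each `A`-linear form on a `B`-module is
`T` composed with a `B`-linear form. If `T` is moreover surjective and local, `nonSplit` means the
same over `A` as over `B` (`nonSplit_eq_of_freelyGeneratesDual`). Thus the free ranks of `F^e_* B`
over `A` and over `B` differ by the factor `[κ(𝔟) : κ(𝔞)]`, and the formula is the limit statement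
for `M = B`. Strong `F`-regularity is transferred along `T` in the same way.

*Quotients by finite group-schemes.* Let `R = S^G`, which may be assumed to be a domain by the
above. It has to be shown that the trace generates `Hom_R(S, R)`
(`GroupSchemeAction.freelyGeneratesDual_trace`), and that `S` has rank `o(G)` over `R`, which
follows by comparing the ranks of `S ⊗_R S` and `S ⊗ 𝒪(G)`.
Left integrals are nondegenerate (`IsLeftIntegral.eq_zero_of_forall_mul`), so the trace form is
nondegenerate at the primes where `S` is a torsor, and the cokernel of `S → Hom_R(S, R)` vanishes
there (`exists_dual_generator_of_nondegenerate`). An associated prime `P` of the cokernel therefore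
has height at least two. For suitable `x, y ∈ P`, regular on `R_P`, it yields a prime `Q` of `S`
over `P` that is associated to `S / x S`, so that `Q` has height one by `S₂`. Then a power of `y`,
times an element outside `Q`, lies in `x S`, which is excluded by the going-down property
`GroupSchemeAction.exists_pow_mem_map_colon`; the latter holds because `α(s)`, acting on the free
`S`-module `S ⊗ 𝒪(G)`, has a characteristic polynomial with coefficients in `R`.
-/

/-! ### The free rank as a length -/

section FreeRank

variable {A : Type u} [CommRing A] [IsLocalRing A] {M : Type v} [AddCommGroup M] [Module A M]
  {N : Type w} [AddCommGroup N] [Module A N]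

variable (A N) in
/-- The elements of a module `N` over a local ring that every linear form sends into the maximal
ideal, that is, those which do not generate a free direct summand. -/
def nonSplit : Submodule A N where
  carrier := {x | ∀ φ : N →ₗ[A] A, φ x ∈ maximalIdeal A}
  add_mem' hx hy φ := by rw [map_add]; exact add_mem (hx φ) (hy φ)
  zero_mem' φ := by rw [map_zero]; exact zero_mem _
  smul_mem' a x hx φ := by rw [map_smul]; exact Ideal.mul_mem_left _ _ (hx φ)

theorem mem_nonSplit {x : N} :
    x ∈ nonSplit A N ↔ ∀ φ : N →ₗ[A] A, φ x ∈ maximalIdeal A := Iff.rfl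

theorem maximalIdeal_smul_le_nonSplit :
    maximalIdeal A • (⊤ : Submodule A N) ≤ nonSplit A N := by
  rw [Submodule.smul_le]
  intro r hr n _ φ
  rw [map_smul]
  exact Ideal.mul_mem_right _ _ hr

theorem map_mem_nonSplit (g : M →ₗ[A] N) {x : M} (hx : x ∈ nonSplit A M) :
    g x ∈ nonSplit A N := fun φ => hx (φ ∘ₗ g)

variable (A) in
theorem length_quotient_maximalIdeal : Module.length A (A ⧸ maximalIdeal A) = 1 := by
  rw [Module.length_eq_one_iff, isSimpleModule_iff_quot_maximal]
  exact ⟨_, inferInstance, ⟨LinearEquiv.refl _ _⟩⟩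

/-- A quotient of a module over a local ring that is killed by the maximal ideal and generated by
`n` elements has length at most `n`. -/
theorem length_quotient_le_card {P : Submodule A N}
    (hP : maximalIdeal A • (⊤ : Submodule A N) ≤ P) {n : ℕ} (x : Fin n → N)
    (hx : ∀ y, ∃ a : Fin n → A, y - ∑ j, a j • x j ∈ P) : Module.length A (N ⧸ P) ≤ n := by
  let g : (Fin n → A ⧸ maximalIdeal A) →ₗ[A] N ⧸ P :=
    ∑ j, (Submodule.liftQ _ (P.mkQ ∘ₗ LinearMap.toSpanSingleton A N (x j)) fun a ha => by
      rw [LinearMap.mem_ker, LinearMap.comp_apply, Submodule.mkQ_apply,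
        Submodule.Quotient.mk_eq_zero, LinearMap.toSpanSingleton_apply]
      exact hP (Submodule.smul_mem_smul ha trivial)) ∘ₗ LinearMap.proj j
  have hg : Function.Surjective g := by
    intro y
    obtain ⟨y, rfl⟩ := Submodule.Quotient.mk_surjective _ y
    obtain ⟨a, ha⟩ := hx y
    refine ⟨fun j => Ideal.Quotient.mk _ (a j), ?_⟩
    rw [(Submodule.Quotient.eq _).mpr ha, LinearMap.sum_apply, ← Submodule.mkQ_apply, map_sum]
    rfl
  have := Module.length_le_of_surjective g hg
  rwa [Module.length_pi, length_quotient_maximalIdeal, mul_one, ENat.card_eq_coe_fintype_card,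
    Fintype.card_fin] at this

theorem apply_eq_sum_single {A : Type u} [CommRing A] {N : Type w} [AddCommGroup N] [Module A N]
    {n : ℕ} (f : (Fin n → A) →ₗ[A] N) (v : Fin n → A) :
    f v = ∑ j, v j • f (Pi.single j 1) := by
  conv_lhs => rw [← Finset.univ_sum_single v]
  rw [map_sum]
  refine Finset.sum_congr rfl fun j _ => ?_
  rw [← map_smul, ← Pi.single_smul, smul_eq_mul, mul_one]

/-- The length of `N / 𝔪 N` is finite: it is the minimal number of generators. -/
theorem length_quotient_smul_top_ne_top [Module.Finite A N] :
    Module.length A (N ⧸ maximalIdeal A • (⊤ : Submodule A N)) ≠ ⊤ := by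
  obtain ⟨n, f, hf⟩ := Module.Finite.exists_fin' A N
  refine ne_top_of_le_ne_top (ENat.natCast_ne_top n)
    (length_quotient_le_card le_rfl (fun j => f (Pi.single j 1)) fun y => ?_)
  obtain ⟨v, rfl⟩ := hf y
  refine ⟨v, ?_⟩
  rw [apply_eq_sum_single, sub_self]
  exact zero_mem _

theorem length_quotient_nonSplit_ne_top [Module.Finite A N] :
    Module.length A (N ⧸ nonSplit A N) ≠ ⊤ :=
  ne_top_of_le_ne_top length_quotient_smul_top_ne_top
    (Module.length_le_of_surjective (Submodule.factor maximalIdeal_smul_le_nonSplit)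
      (Submodule.factor_surjective _))

theorem le_length_of_split {n : ℕ} {i : (Fin n → A) →ₗ[A] N} {q : N →ₗ[A] (Fin n → A)}
    (h : q ∘ₗ i = LinearMap.id) : (n : ℕ∞) ≤ Module.length A (N ⧸ nonSplit A N) := by
  let g : N →ₗ[A] (Fin n → A ⧸ maximalIdeal A) :=
    LinearMap.pi fun j => Submodule.mkQ _ ∘ₗ LinearMap.proj j ∘ₗ q
  have hg : nonSplit A N ≤ LinearMap.ker g := by
    intro x hx
    rw [LinearMap.mem_ker]
    funext j
    exact (Submodule.Quotient.mk_eq_zero _).mpr (hx (LinearMap.proj j ∘ₗ q))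
  have hs : Function.Surjective ((nonSplit A N).liftQ g hg) := by
    intro y
    choose v hv using fun j => Submodule.Quotient.mk_surjective _ (y j)
    refine ⟨Submodule.Quotient.mk (i v), ?_⟩
    have := LinearMap.congr_fun h v
    rw [LinearMap.comp_apply, LinearMap.id_apply] at this
    rw [Submodule.liftQ_apply]
    funext j
    rw [← hv j]
    change Submodule.Quotient.mk (q (i v) j) = _
    rw [this]
  have := Module.length_le_of_surjective _ hs
  rwa [Module.length_pi, length_quotient_maximalIdeal, mul_one, ENat.card_eq_coe_fintype_card,
    Fintype.card_fin] at this

/-- A split free submodule of rank `n` extends to one of rank `n + 1` if some element of the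
complement is not in `nonSplit A N`. -/
theorem exists_split_succ {n : ℕ} {i : (Fin n → A) →ₗ[A] N} {q : N →ₗ[A] (Fin n → A)}
    (h : q ∘ₗ i = LinearMap.id) {x : N} (hqx : q x = 0) (hx : x ∉ nonSplit A N) :
    ∃ (i' : (Fin (n + 1) → A) →ₗ[A] N) (q' : N →ₗ[A] (Fin (n + 1) → A)),
      q' ∘ₗ i' = LinearMap.id := by
  rw [mem_nonSplit, not_forall] at hx
  obtain ⟨φ, hφ⟩ := hx
  have hu : IsUnit (φ x) := by simpa using hφ
  obtain ⟨c, hc⟩ := hu.exists_left_inv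
  let ψ : N →ₗ[A] A := c • (φ - φ ∘ₗ i ∘ₗ q)
  have hi : ∀ v, q (i v) = v := fun v => LinearMap.congr_fun h v
  have hψi : ∀ v, ψ (i v) = 0 := fun v => by simp [ψ, hi]
  have hψx : ψ x = 1 := by simp [ψ, hqx, hc]
  refine ⟨(LinearMap.toSpanSingleton A N x) ∘ₗ LinearMap.proj 0 +
    i ∘ₗ LinearMap.funLeft A A Fin.succ,
    LinearMap.pi (Fin.cons ψ fun j => LinearMap.proj j ∘ₗ q), ?_⟩
  refine LinearMap.ext fun v => funext fun j => ?_
  refine Fin.cases ?_ (fun j => ?_) j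
  · simp [hψi, hψx]
  · simp [hqx, hi, LinearMap.funLeft_apply]

/-- The free rank of a finitely generated module `N` over a local ring is the dimension of
`N / nonSplit A N` over the residue field. -/
theorem freeRank_eq_length [Module.Finite A N] :
    (freeRank A N : ℕ∞) = Module.length A (N ⧸ nonSplit A N) := by
  set S := {n : ℕ | ∃ (i : (Fin n → A) →ₗ[A] N) (q : N →ₗ[A] (Fin n → A)),
    q ∘ₗ i = LinearMap.id} with hS
  have hbdd : BddAbove S := by
    refine ⟨(Module.length A (N ⧸ nonSplit A N)).toNat, ?_⟩
    rintro n ⟨i, q, h⟩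
    exact by
      rw [← ENat.natCast_le_natCast, ENat.natCast_toNat length_quotient_nonSplit_ne_top]
      exact le_length_of_split h
  have hne : S.Nonempty := ⟨0, 0, 0, LinearMap.ext fun v => Subsingleton.elim _ _⟩
  obtain ⟨i, q, h⟩ : freeRank A N ∈ S := Nat.sSup_mem hne hbdd
  refine le_antisymm (le_length_of_split h) ?_
  -- by maximality, the complement of a free summand of largest rank has no free summand
  have hker : LinearMap.ker q ≤ nonSplit A N := by
    intro x hx
    by_contra hx'
    have : freeRank A N + 1 ∈ S := exists_split_succ h hx hx'
    exact absurd (le_csSup hbdd this) (by change ¬ (_ ≤ freeRank A N); omega)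
  refine length_quotient_le_card maximalIdeal_smul_le_nonSplit
    (fun j => i (Pi.single j 1)) fun y => ⟨q y, hker ?_⟩
  rw [← apply_eq_sum_single, LinearMap.mem_ker, map_sub]
  exact sub_eq_zero.mpr (LinearMap.congr_fun h (q y)).symm

theorem freeRank_congr {A : Type u} [CommRing A] {M : Type v} [AddCommGroup M] [Module A M]
    {N : Type w} [AddCommGroup N] [Module A N] (e : M ≃ₗ[A] N) : freeRank A M = freeRank A N := by
  unfold freeRank
  congr 1
  ext n
  constructor
  · rintro ⟨i, q, h⟩
    exact ⟨e.toLinearMap ∘ₗ i, q ∘ₗ e.symm.toLinearMap, by ext; simp [← h]⟩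
  · rintro ⟨i, q, h⟩
    exact ⟨e.symm.toLinearMap ∘ₗ i, q ∘ₗ e.toLinearMap, by ext; simp [← h]⟩

theorem nonSplit_pi (r : ℕ) :
    nonSplit A (Fin r → N) = Submodule.pi Set.univ fun _ => nonSplit A N := by
  classical
  ext x
  rw [Submodule.mem_pi]
  refine ⟨fun h j _ φ => h (φ ∘ₗ LinearMap.proj j), fun h φ => ?_⟩
  rw [← Finset.univ_sum_single x, map_sum]
  exact sum_mem fun j _ => h j trivial (φ ∘ₗ LinearMap.single A (fun _ => N) j)

theorem freeRank_pi [Module.Finite A N] (r : ℕ) :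
    freeRank A (Fin r → N) = r * freeRank A N := by
  classical
  have h : (freeRank A (Fin r → N) : ℕ∞) = (r : ℕ∞) * freeRank A N := by
    rw [freeRank_eq_length, freeRank_eq_length, nonSplit_pi,
      (Submodule.quotientPi fun _ : Fin r => nonSplit A N).length_eq, Module.length_pi,
      ENat.card_eq_coe_fintype_card, Fintype.card_fin]
  exact_mod_cast h

/-- The free rank grows along a map by at most the number of generators of the cokernel. -/
theorem freeRank_le_add_length [Module.Finite A M] [Module.Finite A N] (g : M →ₗ[A] N) :
    (freeRank A N : ℕ∞) ≤ freeRank A M + Module.length A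
      ((N ⧸ LinearMap.range g) ⧸ maximalIdeal A • (⊤ : Submodule A (N ⧸ LinearMap.range g))) := by
  rw [freeRank_eq_length, freeRank_eq_length]
  let f : (M ⧸ nonSplit A M) →ₗ[A] N ⧸ nonSplit A N :=
    Submodule.mapQ _ _ g fun x hx => map_mem_nonSplit g hx
  rw [Module.length_eq_add_of_exact (LinearMap.range f).subtype (LinearMap.range f).mkQ
    (Submodule.subtype_injective _) (Submodule.mkQ_surjective _)
    (LinearMap.exact_subtype_mkQ _)]
  refine add_le_add (Module.length_le_of_surjective f.rangeRestrict f.surjective_rangeRestrict) ?_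
  let k : (N ⧸ LinearMap.range g) →ₗ[A] (N ⧸ nonSplit A N) ⧸ LinearMap.range f :=
    Submodule.mapQ _ _ (Submodule.mkQ _) <| by
      rintro _ ⟨x, rfl⟩
      exact ⟨Submodule.Quotient.mk x, rfl⟩
  have hk : Function.Surjective k := by
    intro y
    obtain ⟨y, rfl⟩ := Submodule.Quotient.mk_surjective _ y
    obtain ⟨y, rfl⟩ := Submodule.Quotient.mk_surjective _ y
    exact ⟨Submodule.Quotient.mk y, rfl⟩
  refine Module.length_le_of_surjective (Submodule.liftQ _ k ?_) ?_
  · rw [Submodule.smul_le]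
    intro r hr n _
    obtain ⟨n, rfl⟩ := Submodule.Quotient.mk_surjective _ n
    rw [LinearMap.mem_ker, map_smul]
    change Submodule.Quotient.mk (Submodule.Quotient.mk (r • n)) = _
    rw [(Submodule.Quotient.mk_eq_zero _).mpr
      (maximalIdeal_smul_le_nonSplit (Submodule.smul_mem_smul hr trivial) : r • n ∈ nonSplit A N)]
    rfl
  · intro y
    obtain ⟨y, rfl⟩ := hk y
    exact ⟨Submodule.Quotient.mk y, rfl⟩

end FreeRank

/-! ### Functoriality of the Frobenius pushforward -/

namespace FrobPush

variable {p : ℕ} {A : Type u} [CommRing A] [ExpChar A p] {M : Type v} [AddCommGroup M] [Module A M]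
  {N : Type w} [AddCommGroup N] [Module A N]

/-- The map `F^e_* g` on Frobenius pushforwards. -/
def map (p e : ℕ) [ExpChar A p] (g : M →ₗ[A] N) : FrobPush p e M →ₗ[A] FrobPush p e N where
  toFun x := of p e (g ((of p e).symm x))
  map_add' x y := by rw [map_add, map_add, map_add]
  map_smul' a x := congrArg (of p e) (g.map_smul (a ^ p ^ e) ((of p e).symm x))

@[simp]
theorem map_of (e : ℕ) (g : M →ₗ[A] N) (x : M) : map p e g (of p e x) = of p e (g x) := rfl

theorem map_surjective (e : ℕ) {g : M →ₗ[A] N} (hg : Function.Surjective g) :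
    Function.Surjective (map p e g) := hg

/-- An isomorphism of modules induces one of Frobenius pushforwards. -/
noncomputable def congr (p e : ℕ) [ExpChar A p] (g : M ≃ₗ[A] N) :
    FrobPush p e M ≃ₗ[A] FrobPush p e N :=
  LinearEquiv.ofBijective (map p e g.toLinearMap) g.bijective

/-- The Frobenius pushforward commutes with finite powers. -/
def piEquiv (p e : ℕ) [ExpChar A p] (M : Type v) [AddCommGroup M] [Module A M] (ι : Type*) :
    FrobPush p e (ι → M) ≃ₗ[A] (ι → FrobPush p e M) where
  toFun x := x
  invFun x := x
  map_add' _ _ := rfl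
  map_smul' _ _ := rfl

/-- `F^e_* F^d_* M = F^{d+e}_* M`. -/
def compEquiv (p d e : ℕ) [ExpChar A p] (M : Type v) [AddCommGroup M] [Module A M] :
    FrobPush p e (FrobPush p d M) ≃ₗ[A] FrobPush p (d + e) M where
  toFun x := x
  invFun x := x
  map_add' _ _ := rfl
  map_smul' a (x : M) := by
    change (a ^ p ^ e) ^ p ^ d • x = a ^ p ^ (d + e) • x
    rw [← pow_mul, ← pow_add, add_comm e d]

/-- `F^0_* M = M`. -/
def zeroEquiv (p : ℕ) [ExpChar A p] (M : Type v) [AddCommGroup M] [Module A M] :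
    FrobPush p 0 M ≃ₗ[A] M where
  toFun x := x
  invFun x := x
  map_add' _ _ := rfl
  map_smul' a (x : M) := by
    change a ^ p ^ 0 • x = a • x
    rw [pow_zero, pow_one]

theorem finite_self (h : IsFFinite p A) : Module.Finite A (FrobPush p 1 A) := by
  obtain ⟨s, hs⟩ := h
  refine ⟨⟨s.map (of p 1).toEquiv.toEmbedding, ?_⟩⟩
  rw [eq_top_iff]
  intro x _
  have hx : (of p 1).symm x ∈ (⊤ : @Submodule A A _ _ (frobenius A p).toAlgebra.toModule) := trivial
  rw [← hs] at hx
  refine @Submodule.span_induction A A _ _ (frobenius A p).toAlgebra.toModule s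
    (p := fun y _ => of p 1 y ∈ Submodule.span A (s.map (of p 1).toEquiv.toEmbedding :
      Set (FrobPush p 1 A))) ?_ ?_ ?_ ?_ _ hx
  · exact fun y hy => Submodule.subset_span (Finset.mem_map_of_mem _ hy)
  · exact zero_mem _
  · exact fun y z _ _ hy hz => add_mem hy hz
  · intro a y _ hy
    have h1 := Submodule.smul_mem _ a hy
    rw [smul_of, pow_one] at h1
    exact h1

theorem finite_one (h : IsFFinite p A) [Module.Finite A M] : Module.Finite A (FrobPush p 1 M) := by
  obtain ⟨n, f, hf⟩ := Module.Finite.exists_fin' A M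
  have := finite_self h
  have := Module.Finite.equiv (piEquiv p 1 A (Fin n) : FrobPush p 1 (Fin n → A) ≃ₗ[A] _).symm
  exact Module.Finite.of_surjective _ (map_surjective 1 hf)

theorem finite (h : IsFFinite p A) [Module.Finite A M] (e : ℕ) :
    Module.Finite A (FrobPush p e M) := by
  induction e with
  | zero => exact Module.Finite.equiv (zeroEquiv p M).symm
  | succ e ih =>
    have := finite_one (M := FrobPush p e M) h
    exact Module.Finite.equiv (compEquiv p e 1 M)

end FrobPush

theorem Module.length_le_add {A : Type*} [Ring A] {N M P : Type*} [AddCommGroup N]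
    [AddCommGroup M] [AddCommGroup P] [Module A N] [Module A M] [Module A P] (f : N →ₗ[A] M)
    (g : M →ₗ[A] P) (h : LinearMap.ker g ≤ LinearMap.range f) :
    Module.length A M ≤ Module.length A N + Module.length A P := by
  rw [Module.length_eq_add_of_exact (LinearMap.ker g).subtype g.rangeRestrict
    (Submodule.subtype_injective _) g.surjective_rangeRestrict fun x => by
      simp [LinearMap.rangeRestrict, Subtype.ext_iff]]
  refine add_le_add ?_ (Module.length_le_of_injective _ (Submodule.subtype_injective _))
  exact (Module.length_le_of_injective _ (Submodule.inclusion_injective h)).trans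
    (Module.length_le_of_surjective f.rangeRestrict f.surjective_rangeRestrict)

/-! ### Length of Frobenius pushforwards -/

section Length

variable {p : ℕ} [Fact p.Prime] {A : Type u} [CommRing A] [IsLocalRing A] [CharP A p]

theorem length_frobPush_residueField (h : IsFFinite p A) :
    Module.length A (FrobPush p 1 (ResidueField A)) = residueFrobDegree p A := by
  have hA : Module.Finite A (FrobPush p 1 (ResidueField A)) := FrobPush.finite h 1
  have : IsScalarTower A (ResidueField A) (FrobPush p 1 (ResidueField A)) := by
    refine ⟨fun a b (x : ResidueField A) => ?_⟩
    change (a • b) ^ p ^ 1 * x = (a ^ p ^ 1) • (b ^ p ^ 1 * x)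
    rw [smul_pow, smul_mul_assoc]
  have : Module.Finite (ResidueField A) (FrobPush p 1 (ResidueField A)) :=
    Module.Finite.of_restrictScalars_finite A _ _
  rw [Module.length_eq_of_surjective (R := ResidueField A) residue_surjective,
    Module.length_eq_finrank]
  rfl

theorem residueFrobDegree_pos (h : IsFFinite p A) : 0 < residueFrobDegree p A := by
  have h1 := length_frobPush_residueField h
  have : Nontrivial (FrobPush p 1 (ResidueField A)) :=
    inferInstanceAs (Nontrivial (ResidueField A))
  have h2 : 0 < Module.length A (FrobPush p 1 (ResidueField A)) := Module.length_pos
  rw [h1] at h2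
  exact_mod_cast h2

theorem length_frobPush_one_le (h : IsFFinite p A) {N : Type w} [AddCommGroup N] [Module A N] :
    Module.length A (FrobPush p 1 N) ≤ residueFrobDegree p A * Module.length A N := by
  by_cases hN : IsFiniteLength A N
  · induction hN with
    | @of_subsingleton N _ _ _ =>
      have : Subsingleton (FrobPush p 1 N) := inferInstanceAs (Subsingleton N)
      rw [Module.length_eq_zero]
      exact zero_le
    | @of_simple_quotient M _ _ N hs hN ih =>
      obtain ⟨I, hI, ⟨e⟩⟩ := isSimpleModule_iff_quot_maximal.mp hs
      obtain rfl := IsLocalRing.eq_maximalIdeal hI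
      have h1 : Module.length A (FrobPush p 1 (M ⧸ N)) = residueFrobDegree p A := by
        rw [(FrobPush.congr p 1 e).length_eq]
        exact length_frobPush_residueField h
      have h2 := Module.length_le_add (FrobPush.map p 1 N.subtype) (FrobPush.map p 1 N.mkQ)
        fun x hx => ⟨FrobPush.of p 1 ⟨x, (Submodule.Quotient.mk_eq_zero N).mp hx⟩, rfl⟩
      rw [Module.length_eq_add_of_exact N.subtype N.mkQ (Submodule.subtype_injective _)
        (Submodule.mkQ_surjective _) (LinearMap.exact_subtype_mkQ _),
        Module.length_eq_one A (M ⧸ N),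
        mul_add, mul_one]
      rw [h1] at h2
      exact h2.trans (add_le_add ih le_rfl)
  · rw [← Module.length_ne_top_iff, not_not] at hN
    rw [hN, ENat.mul_top]
    · exact le_top
    · exact_mod_cast (residueFrobDegree_pos h).ne'

theorem length_frobPush_le (h : IsFFinite p A) {N : Type w} [AddCommGroup N] [Module A N] (e : ℕ) :
    Module.length A (FrobPush p e N) ≤ (residueFrobDegree p A) ^ e * Module.length A N := by
  induction e with
  | zero => rw [(FrobPush.zeroEquiv p N).length_eq, pow_zero, one_mul]
  | succ e ih =>
    rw [← (FrobPush.compEquiv p e 1 N).length_eq, pow_succ', mul_assoc]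
    exact (length_frobPush_one_le h).trans (by gcongr)

end Length

/-! ### Growth of colengths of Frobenius powers -/

section Growth

variable {A : Type u} [CommRing A] {M : Type v} [AddCommGroup M] [Module A M]

/-- Multiplication by `a ^ q` maps `M / (J, a) M` onto the kernel of
`M / (J, a ^ (q + 1)) M → M / (J, a ^ q) M`. -/
theorem length_quotient_sup_span_pow_le (J : Ideal A) (a : A) (q : ℕ) :
    Module.length A (M ⧸ (J ⊔ Ideal.span {a ^ q}) • (⊤ : Submodule A M)) ≤
      q * Module.length A (M ⧸ (J ⊔ Ideal.span {a}) • (⊤ : Submodule A M)) := by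
  induction q with
  | zero =>
    have : Subsingleton (M ⧸ (J ⊔ Ideal.span {a ^ 0}) • (⊤ : Submodule A M)) := by
      rw [pow_zero, Ideal.span_singleton_one, sup_top_eq, Submodule.top_smul]
      exact Submodule.Quotient.subsingleton_iff.mpr rfl
    rw [Module.length_eq_zero]
    exact zero_le
  | succ q ih =>
    let f : (M ⧸ (J ⊔ Ideal.span {a}) • (⊤ : Submodule A M)) →ₗ[A]
        M ⧸ (J ⊔ Ideal.span {a ^ (q + 1)}) • (⊤ : Submodule A M) :=
      Submodule.mapQ _ _ (LinearMap.lsmul A M (a ^ q)) <| by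
        rw [Submodule.smul_le]
        intro r hr n _
        rw [Submodule.mem_comap, map_smul, LinearMap.lsmul_apply, smul_smul]
        refine Submodule.smul_mem_smul ?_ trivial
        obtain ⟨j, hj, b, hb, rfl⟩ := Submodule.mem_sup.mp hr
        obtain ⟨c, rfl⟩ := Ideal.mem_span_singleton'.mp hb
        rw [add_mul]
        refine add_mem (Ideal.mem_sup_left (Ideal.mul_mem_right _ _ hj)) (Ideal.mem_sup_right ?_)
        exact Ideal.mem_span_singleton'.mpr ⟨c, by ring⟩
    have hle : J ⊔ Ideal.span {a ^ (q + 1)} ≤ J ⊔ Ideal.span {a ^ q} := by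
      refine sup_le_sup_left ?_ _
      rw [Ideal.span_singleton_le_span_singleton]
      exact pow_dvd_pow a (Nat.le_succ q)
    let g : (M ⧸ (J ⊔ Ideal.span {a ^ (q + 1)}) • (⊤ : Submodule A M)) →ₗ[A]
        M ⧸ (J ⊔ Ideal.span {a ^ q}) • (⊤ : Submodule A M) :=
      Submodule.factor (Submodule.smul_mono_left hle)
    have h := Module.length_le_add f g <| by
      intro y hy
      obtain ⟨y, rfl⟩ := Submodule.Quotient.mk_surjective _ y
      have hy' : y ∈ (J ⊔ Ideal.span {a ^ q}) • (⊤ : Submodule A M) :=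
        (Submodule.Quotient.mk_eq_zero _).mp hy
      rw [Submodule.sup_smul, Submodule.ideal_span_singleton_smul] at hy'
      obtain ⟨j, hj, b, ⟨c, -, rfl⟩, rfl⟩ := Submodule.mem_sup.mp hy'
      refine ⟨Submodule.Quotient.mk c, ?_⟩
      refine (Submodule.Quotient.eq _).mpr ?_
      change a ^ q • c - (j + a ^ q • c) ∈ _
      rw [sub_add_cancel_right]
      exact neg_mem (Submodule.smul_mono_left le_sup_left hj)
    refine h.trans ?_
    rw [Nat.cast_succ, add_mul, one_mul, add_comm]
    exact add_le_add ih le_rfl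

open Classical in
theorem length_quotient_span_image_pow_le (q : ℕ) (s : Finset A) (J : Ideal A) :
    Module.length A (M ⧸ (J ⊔ Ideal.span ((· ^ q) '' (s : Set A))) • (⊤ : Submodule A M)) ≤
      (q : ℕ∞) ^ s.card *
        Module.length A (M ⧸ (J ⊔ Ideal.span (s : Set A)) • (⊤ : Submodule A M)) := by
  induction s using Finset.induction_on generalizing J with
  | empty => rw [Finset.coe_empty, Set.image_empty, Finset.card_empty, pow_zero, one_mul]
  | insert a s ha ih =>
    have h1 := ih (J ⊔ Ideal.span {a ^ q})
    have h2 := length_quotient_sup_span_pow_le (M := M) (J ⊔ Ideal.span (s : Set A)) a q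
    rw [sup_assoc, ← Ideal.span_union, ← Set.insert_eq, sup_right_comm] at h1
    rw [sup_assoc _ _ (Ideal.span {a}), ← Ideal.span_union, Set.union_singleton] at h2
    rw [Finset.coe_insert, Set.image_insert_eq, Finset.card_insert_of_notMem ha, pow_succ,
      mul_assoc]
    exact h1.trans (by gcongr)

variable [IsLocalRing A]

theorem length_ne_top_of_pow_smul_eq_bot [IsNoetherianRing A] (n : ℕ) (M : Type v)
    [AddCommGroup M] [Module A M] [Module.Finite A M]
    (h : maximalIdeal A ^ n • (⊤ : Submodule A M) = ⊥) : Module.length A M ≠ ⊤ := by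
  induction n generalizing M with
  | zero =>
    rw [pow_zero, Ideal.one_eq_top, Submodule.top_smul] at h
    have : Subsingleton M := (Submodule.subsingleton_iff A).mp (subsingleton_of_bot_eq_top h.symm)
    rw [Module.length_eq_zero]
    exact ENat.zero_ne_top
  | succ n ih =>
    let N : Submodule A M := maximalIdeal A • ⊤
    have hN : maximalIdeal A ^ n • (⊤ : Submodule A N) = ⊥ := by
      apply Submodule.map_injective_of_injective N.subtype_injective
      rw [Submodule.map_smul'', Submodule.map_top, Submodule.range_subtype, Submodule.map_bot,
        ← h, pow_succ, Submodule.mul_smul]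
    rw [Module.length_eq_add_of_exact N.subtype N.mkQ (Submodule.subtype_injective _)
      (Submodule.mkQ_surjective _) (LinearMap.exact_subtype_mkQ _)]
    exact WithTop.add_ne_top.mpr ⟨ih N hN, length_quotient_smul_top_ne_top⟩

theorem length_quotient_smul_ne_top_of_radical [IsNoetherianRing A] [Module.Finite A M]
    {J : Ideal A} (hJ : maximalIdeal A ≤ J.radical) :
    Module.length A (M ⧸ J • (⊤ : Submodule A M)) ≠ ⊤ := by
  obtain ⟨n, hn⟩ := Ideal.exists_pow_le_of_le_radical_of_fg hJ (IsNoetherian.noetherian _)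
  refine length_ne_top_of_pow_smul_eq_bot n _ (le_bot_iff.mp (Submodule.smul_le.mpr ?_))
  intro r hr y _
  obtain ⟨y, rfl⟩ := Submodule.Quotient.mk_surjective _ y
  rw [Submodule.mem_bot, ← Submodule.Quotient.mk_smul, Submodule.Quotient.mk_eq_zero]
  exact Submodule.smul_mem_smul (hn hr) trivial

/-- Lifting a system of parameters of `A / I`. -/
theorem exists_parameters [IsNoetherianRing A] {I : Ideal A} (hI : I ≠ ⊤) :
    ∃ s : Finset A, (s : Set A) ⊆ maximalIdeal A ∧ (s.card : WithBot ℕ∞) ≤ ringKrullDim (A ⧸ I) ∧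
      maximalIdeal A ≤ (I ⊔ Ideal.span (s : Set A)).radical := by
  classical
  have : Nontrivial (A ⧸ I) := Ideal.Quotient.nontrivial_iff.mpr hI
  have : IsLocalRing (A ⧸ I) := .of_surjective' (Ideal.Quotient.mk I) Ideal.Quotient.mk_surjective
  obtain ⟨t, ht, hc⟩ := (maximalIdeal (A ⧸ I)).exists_finset_card_eq_height_of_isNoetherianRing
  choose σ hσ using Ideal.Quotient.mk_surjective (I := I)
  have himg : Ideal.Quotient.mk I '' ((t.image σ : Finset A) : Set A) = t := by
    rw [Finset.coe_image, Set.image_image]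
    simp [hσ]
  have hcomap : (maximalIdeal (A ⧸ I)).comap (Ideal.Quotient.mk I) = maximalIdeal A :=
    have := Ideal.comap_isMaximal_of_surjective (Ideal.Quotient.mk I) Ideal.Quotient.mk_surjective
      (K := maximalIdeal (A ⧸ I))
    IsLocalRing.eq_maximalIdeal this
  refine ⟨t.image σ, ?_, ?_, ?_⟩
  · intro x hx
    rw [SetLike.mem_coe, ← hcomap, Ideal.mem_comap]
    exact ht.1.2 (Ideal.subset_span (himg ▸ Set.mem_image_of_mem _ hx))
  · rw [← IsLocalRing.maximalIdeal_height_eq_ringKrullDim, ← hc]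
    exact_mod_cast Finset.card_image_le
  · rw [Ideal.radical_eq_sInf]
    refine le_sInf ?_
    rintro P ⟨hP, hPp⟩
    have hIP : I ≤ P := le_sup_left.trans hP
    have h1 : P.map (Ideal.Quotient.mk I) ≤ maximalIdeal (A ⧸ I) := by
      refine IsLocalRing.le_maximalIdeal fun h => hPp.ne_top ?_
      have := Ideal.comap_map_quotientMk I P
      rw [h, Ideal.comap_top, sup_eq_right.mpr hIP] at this
      exact this.symm
    have hmp : (P.map (Ideal.Quotient.mk I)).IsPrime :=
      Ideal.map_isPrime_of_surjective Ideal.Quotient.mk_surjective (by rwa [Ideal.mk_ker])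
    have h2 := ht.2 ⟨hmp, by
      rw [← himg, ← Ideal.map_span]
      exact Ideal.map_mono (le_sup_right.trans hP)⟩ h1
    rw [← hcomap]
    refine (Ideal.comap_mono h2).trans ?_
    rw [Ideal.comap_map_quotientMk, sup_eq_right.mpr hIP]

variable {p : ℕ} [Fact p.Prime] [CharP A p]

/-- The number of generators of `F^e_* M` is bounded by means of any set `s` of elements of the
maximal ideal: `F^e_* M / 𝔪 F^e_* M` is a quotient of `F^e_* (M / s^[p ^ e] M)`. -/
theorem length_frobPush_quotient_le (h : IsFFinite p A) {s : Finset A}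
    (hs : (s : Set A) ⊆ maximalIdeal A) (e : ℕ) :
    Module.length A (FrobPush p e M ⧸ maximalIdeal A • (⊤ : Submodule A (FrobPush p e M))) ≤
      (residueFrobDegree p A : ℕ∞) ^ e * (((p ^ e : ℕ) : ℕ∞) ^ s.card *
        Module.length A (M ⧸ Ideal.span (s : Set A) • (⊤ : Submodule A M))) := by
  let P : Submodule A M := Ideal.span ((· ^ p ^ e) '' (s : Set A)) • (⊤ : Submodule A M)
  have h1 := length_quotient_span_image_pow_le (M := M) (p ^ e) s ⊥
  rw [bot_sup_eq, bot_sup_eq] at h1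
  refine le_trans ?_ (mul_le_mul_right h1 _)
  refine le_trans ?_ (length_frobPush_le (N := M ⧸ P) h e)
  have hle : LinearMap.ker (FrobPush.map p e P.mkQ) ≤
      maximalIdeal A • (⊤ : Submodule A (FrobPush p e M)) := by
    intro x hx
    have hx' : (x : M) ∈ P := (Submodule.Quotient.mk_eq_zero P).mp hx
    refine Submodule.smul_induction_on
      (p := fun y => FrobPush.of p e y ∈ maximalIdeal A • (⊤ : Submodule A (FrobPush p e M)))
      hx' (fun r hr n _ => ?_) fun y z hy hz => add_mem hy hz
    induction hr using Submodule.span_induction generalizing n with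
    | mem r hr =>
      obtain ⟨a, ha, rfl⟩ := hr
      exact Submodule.smul_mem_smul (N := (⊤ : Submodule A (FrobPush p e M))) (hs ha) trivial
    | zero => rw [zero_smul]; exact zero_mem _
    | add y z _ _ hy hz => rw [add_smul]; exact add_mem (hy n trivial) (hz n trivial)
    | smul a y _ hy => rw [smul_assoc, smul_comm]; exact hy (a • n) trivial
  refine Module.length_le_of_surjective ((LinearMap.ker (FrobPush.map p e P.mkQ)).factor hle ∘ₗ
    ((FrobPush.map p e P.mkQ).quotKerEquivOfSurjective
      (FrobPush.map_surjective e P.mkQ_surjective)).symm.toLinearMap) ?_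
  exact (Submodule.factor_surjective hle).comp (LinearEquiv.surjective _)

/-- If `I` kills `M`, the number of generators of `F^e_* M` is `O((p ^ dim (A / I) * f) ^ e)`, where
`f` is the degree of Frobenius on the residue field. -/
theorem exists_frobPush_generators_le [IsNoetherianRing A] [Module.Finite A M] (h : IsFFinite p A)
    {I : Ideal A} (hI : I ≠ ⊤) (hM : I • (⊤ : Submodule A M) = ⊥) :
    ∃ n C : ℕ, (n : WithBot ℕ∞) ≤ ringKrullDim (A ⧸ I) ∧ ∀ e,
      Module.length A (FrobPush p e M ⧸ maximalIdeal A • (⊤ : Submodule A (FrobPush p e M))) ≤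
        ((C * (p ^ n * residueFrobDegree p A) ^ e : ℕ) : ℕ∞) := by
  obtain ⟨s, hs, hc, hr⟩ := exists_parameters hI
  have hfin := length_quotient_smul_ne_top_of_radical (M := M) hr
  rw [Submodule.sup_smul, hM, bot_sup_eq] at hfin
  obtain ⟨C, hC⟩ := ENat.ne_top_iff_exists.mp hfin
  refine ⟨s.card, C, hc, fun e => (length_frobPush_quotient_le h hs e).trans_eq ?_⟩
  rw [← hC, mul_pow, ← pow_mul, mul_comm s.card, pow_mul]
  push_cast
  ring

theorem dimNat_eq [IsNoetherianRing A] : (dimNat A : WithBot ℕ∞) = ringKrullDim A := by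
  unfold dimNat
  obtain ⟨n, hn⟩ : ∃ n : ℕ, ringKrullDim A = n := by
    have h1 := ringKrullDim_ne_bot (R := A)
    have h2 := ringKrullDim_ne_top (R := A)
    generalize ringKrullDim A = d at h1 h2
    induction d with
    | bot => exact absurd rfl h1
    | coe d =>
      induction d with
      | top => exact absurd rfl h2
      | coe d => exact ⟨d, rfl⟩
  rw [hn]
  rfl

theorem exists_frobPush_generators_le_dim [IsNoetherianRing A] (h : IsFFinite p A) (M : Type v)
    [AddCommGroup M] [Module A M] [Module.Finite A M] :
    ∃ C : ℕ, ∀ e,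
      Module.length A (FrobPush p e M ⧸ maximalIdeal A • (⊤ : Submodule A (FrobPush p e M))) ≤
        ((C * (p ^ dimNat A * residueFrobDegree p A) ^ e : ℕ) : ℕ∞) := by
  obtain ⟨n, C, hn, hC⟩ := exists_frobPush_generators_le (M := M) h (I := ⊥)
    bot_ne_top (Submodule.bot_smul _)
  refine ⟨C, fun e => (hC e).trans ?_⟩
  have hn' : n ≤ dimNat A := by
    have := hn.trans (ringKrullDim_quotient_le _)
    rw [← dimNat_eq] at this
    exact_mod_cast this
  have := (Fact.out : p.Prime).pos
  gcongr

/-- If `M` is killed by a nonzerodivisor, then the number of generators of `F^e_* M` is smaller by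
a factor `p ^ e`. -/
theorem exists_frobPush_generators_le_of_smul_eq_zero [IsNoetherianRing A] (h : IsFFinite p A)
    (M : Type v) [AddCommGroup M] [Module A M] [Module.Finite A M] {c : A}
    (hc : c ∈ nonZeroDivisors A) (hM : ∀ x : M, c • x = 0) :
    ∃ C : ℕ, ∀ e, (p : ℕ∞) ^ e *
      Module.length A (FrobPush p e M ⧸ maximalIdeal A • (⊤ : Submodule A (FrobPush p e M))) ≤
        ((C * (p ^ dimNat A * residueFrobDegree p A) ^ e : ℕ) : ℕ∞) := by
  by_cases hu : IsUnit c
  · have : Subsingleton M := subsingleton_of_forall_eq 0 fun x => hu.smul_eq_zero.mp (hM x)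
    refine ⟨0, fun e => ?_⟩
    have : Subsingleton (FrobPush p e M) := inferInstanceAs (Subsingleton M)
    rw [Module.length_eq_zero, mul_zero]
    exact zero_le
  obtain ⟨n, C, hn, hC⟩ := exists_frobPush_generators_le (M := M) h (I := Ideal.span {c})
    (by rwa [Ne, Ideal.span_singleton_eq_top])
    (by
      rw [Submodule.ideal_span_singleton_smul, eq_bot_iff]
      rintro _ ⟨x, -, rfl⟩
      exact hM x)
  -- dividing by a nonzerodivisor lowers the dimension
  have hn' : n + 1 ≤ dimNat A := by
    have h1 : (n : WithBot ℕ∞) + 1 ≤ ringKrullDim A :=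
      (add_le_add hn le_rfl).trans (ringKrullDim_quotient_succ_le_of_nonZeroDivisor hc)
    rw [← dimNat_eq] at h1
    exact_mod_cast h1
  refine ⟨C, fun e => (mul_le_mul_right (hC e) _).trans ?_⟩
  have hp := (Fact.out : p.Prime).pos
  rw [← Nat.cast_pow, ← Nat.cast_mul, ENat.natCast_le_natCast]
  calc p ^ e * (C * (p ^ n * residueFrobDegree p A) ^ e)
      = C * (p ^ (n + 1) * residueFrobDegree p A) ^ e := by ring
    _ ≤ _ := by
      gcongr

end Growth

/-! ### Comparison of Frobenius splitting numbers -/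

section Comparison

theorem length_quotient_smul_le_of_surjective {A : Type u} [CommRing A] {M : Type v}
    [AddCommGroup M] [Module A M] {N : Type w} [AddCommGroup N] [Module A N] (I : Ideal A)
    {g : M →ₗ[A] N} (hg : Function.Surjective g) :
    Module.length A (N ⧸ I • (⊤ : Submodule A N)) ≤
      Module.length A (M ⧸ I • (⊤ : Submodule A M)) := by
  refine Module.length_le_of_surjective (Submodule.mapQ _ _ g ?_) ?_
  · rw [← Submodule.map_le_iff_le_comap, Submodule.map_smul'']
    exact Submodule.smul_mono le_rfl le_top
  · intro y
    obtain ⟨y, rfl⟩ := Submodule.Quotient.mk_surjective _ y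
    obtain ⟨x, rfl⟩ := hg y
    exact ⟨Submodule.Quotient.mk x, rfl⟩

variable (p : ℕ) [Fact p.Prime] (A : Type u) [CommRing A] [IsLocalRing A] [CharP A p]

/-- The rank `p ^ δ = p ^ dim A * [κ ^ (1/p) : κ]` by which splitting numbers are normalized. -/
noncomputable def frobRank : ℝ := (p : ℝ) ^ dimNat A * residueFrobDegree p A

/-- The normalized splitting numbers of a module `M`. -/
noncomputable def splittingRatio (M : Type v) [AddCommGroup M] [Module A M] (e : ℕ) : ℝ :=
  (freeRank A (FrobPush p e M) : ℝ) / frobRank p A ^ e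

theorem splittingRatio_self : splittingRatio p A A = fSplittingRatio p A := rfl

variable {p A}

theorem frobRank_pos (h : IsFFinite p A) : 0 < frobRank p A := by
  have := (Fact.out : p.Prime).pos
  have := residueFrobDegree_pos h
  unfold frobRank
  positivity

theorem splittingRatio_nonneg (h : IsFFinite p A) (M : Type v) [AddCommGroup M] [Module A M]
    (e : ℕ) : 0 ≤ splittingRatio p A M e :=
  div_nonneg (Nat.cast_nonneg _) (pow_nonneg (frobRank_pos h).le _)

theorem le_div_of_generators_le (h : IsFFinite p A) {C e : ℕ} {l a b : ℕ} (hab : a ≤ b + l)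
    (hl : p ^ e * l ≤ C * (p ^ dimNat A * residueFrobDegree p A) ^ e) :
    (a : ℝ) / frobRank p A ^ e ≤ b / frobRank p A ^ e + C * (1 / (p : ℝ)) ^ e := by
  have hD := pow_pos (frobRank_pos h) e
  have hp : (0 : ℝ) < (p : ℝ) ^ e := by
    have := (Fact.out : p.Prime).pos
    positivity
  have hl' : (p : ℝ) ^ e * l ≤ C * frobRank p A ^ e := by
    unfold frobRank
    exact_mod_cast hl
  have hab' : (a : ℝ) ≤ b + l := by exact_mod_cast hab
  rw [← sub_le_iff_le_add', ← sub_div, div_le_iff₀ hD, one_div, inv_pow]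
  refine (sub_le_iff_le_add'.mpr hab').trans ?_
  rw [mul_right_comm, ← div_eq_mul_inv, le_div_iff₀ hp]
  linarith

theorem splittingRatio_pi (h : IsFFinite p A) (r e : ℕ) :
    splittingRatio p A (Fin r → A) e = r * splittingRatio p A A e := by
  have := FrobPush.finite (M := A) h e
  unfold splittingRatio
  rw [freeRank_congr (FrobPush.piEquiv p e A (Fin r)), freeRank_pi, Nat.cast_mul, mul_div_assoc]

variable [IsNoetherianRing A]

theorem splittingRatio_bounded (h : IsFFinite p A) (M : Type v) [AddCommGroup M] [Module A M]
    [Module.Finite A M] : ∃ C : ℝ, ∀ e, splittingRatio p A M e ≤ C := by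
  obtain ⟨C, hC⟩ := exists_frobPush_generators_le_dim h M
  refine ⟨C, fun e => ?_⟩
  have := FrobPush.finite (M := M) h e
  have h1 : (freeRank A (FrobPush p e M) : ℕ∞) ≤
      ((C * (p ^ dimNat A * residueFrobDegree p A) ^ e : ℕ) : ℕ∞) := by
    rw [freeRank_eq_length]
    exact (Module.length_le_of_surjective (Submodule.factor maximalIdeal_smul_le_nonSplit)
      (Submodule.factor_surjective _)).trans (hC e)
  have h2 : (freeRank A (FrobPush p e M) : ℝ) ≤ C * frobRank p A ^ e := by
    unfold frobRank
    exact_mod_cast h1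
  unfold splittingRatio
  rwa [div_le_iff₀ (pow_pos (frobRank_pos h) e)]

/-- Along a map whose cokernel is killed by a nonzerodivisor, the normalized splitting numbers grow
by at most `O(1 / p ^ e)`. -/
theorem splittingRatio_le_add (h : IsFFinite p A) {M : Type v} [AddCommGroup M] [Module A M]
    [Module.Finite A M] {N : Type w} [AddCommGroup N] [Module A N] [Module.Finite A N]
    (g : M →ₗ[A] N) {c : A} (hc : c ∈ nonZeroDivisors A)
    (hg : ∀ x : N, c • x ∈ LinearMap.range g) :
    ∃ C : ℝ, ∀ e, splittingRatio p A N e ≤ splittingRatio p A M e + C * (1 / (p : ℝ)) ^ e := by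
  obtain ⟨C, hC⟩ := exists_frobPush_generators_le_of_smul_eq_zero h (N ⧸ LinearMap.range g) hc
    fun x => by
      obtain ⟨x, rfl⟩ := Submodule.Quotient.mk_surjective _ x
      exact (Submodule.Quotient.mk_eq_zero _).mpr (hg x)
  refine ⟨C, fun e => ?_⟩
  have := FrobPush.finite (M := M) h e
  have := FrobPush.finite (M := N) h e
  have := FrobPush.finite (M := N ⧸ LinearMap.range g) h e
  have hle : LinearMap.ker (FrobPush.map p e (LinearMap.range g).mkQ) ≤
      LinearMap.range (FrobPush.map p e g) := by
    intro x hx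
    obtain ⟨y, hy⟩ := (Submodule.Quotient.mk_eq_zero (LinearMap.range g)).mp hx
    exact ⟨FrobPush.of p e y, hy⟩
  let k : FrobPush p e (N ⧸ LinearMap.range g) →ₗ[A]
      FrobPush p e N ⧸ LinearMap.range (FrobPush.map p e g) :=
    Submodule.factor hle ∘ₗ
      ((FrobPush.map p e (LinearMap.range g).mkQ).quotKerEquivOfSurjective
        (FrobPush.map_surjective e (LinearMap.range g).mkQ_surjective)).symm.toLinearMap
  have hk := length_quotient_smul_le_of_surjective (maximalIdeal A) (g := k)
    ((Submodule.factor_surjective hle).comp (LinearEquiv.surjective _))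
  obtain ⟨l, hl⟩ := ENat.ne_top_iff_exists.mp (length_quotient_smul_top_ne_top (A := A)
    (N := FrobPush p e (N ⧸ LinearMap.range g)))
  have h1 := (freeRank_le_add_length (FrobPush.map p e g)).trans (add_le_add le_rfl hk)
  have h2 := hC e
  rw [← hl] at h1 h2
  exact le_div_of_generators_le h (by exact_mod_cast h1) (by exact_mod_cast h2)

/-- A finitely generated module over a domain is generically free. -/
theorem exists_generic_isomorphism (A : Type u) [CommRing A] [IsDomain A] (M : Type v)
    [AddCommGroup M] [Module A M] [Module.Finite A M] :
    ∃ (f : (Fin (Module.finrank A M) → A) →ₗ[A] M) (g : M →ₗ[A] (Fin (Module.finrank A M) → A))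
      (c : A), c ≠ 0 ∧ (∀ x, c • x ∈ LinearMap.range f) ∧ ∀ x, c • x ∈ LinearMap.range g := by
  obtain ⟨v, hv⟩ := exists_linearIndependent_of_le_finrank (le_refl (Module.finrank A M))
  let f := Fintype.linearCombination A v
  have hf : LinearMap.ker f = ⊥ := by
    rw [LinearMap.ker_eq_bot']
    intro a ha
    exact funext (Fintype.linearIndependent_iff.mp hv a ha)
  have hr : LinearMap.range f = Submodule.span A (Set.range v) :=
    Fintype.range_linearCombination A v
  have ht : Module.IsTorsion A (M ⧸ LinearMap.range f) := by
    rw [← Module.finrank_eq_zero_iff_isTorsion]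
    have h1 := Submodule.finrank_quotient_add_finrank (LinearMap.range f)
    have h2 := finrank_span_eq_card hv
    rw [← hr, Fintype.card_fin] at h2
    omega
  obtain ⟨c, hc, hc0⟩ := Submodule.annihilator_top_inter_nonZeroDivisors ht
  have hcf : ∀ x, c • x ∈ LinearMap.range f := fun x =>
    (Submodule.Quotient.mk_eq_zero (LinearMap.range f)).mp
      (Submodule.mem_annihilator.mp hc (Submodule.Quotient.mk x) trivial)
  -- `g` is multiplication by `c`, read in the free submodule `range f`
  let e := LinearEquiv.ofInjective f (LinearMap.ker_eq_bot.mp hf)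
  let g : M →ₗ[A] (Fin (Module.finrank A M) → A) :=
    e.symm.toLinearMap ∘ₗ (LinearMap.lsmul A M c).codRestrict _ hcf
  refine ⟨f, g, c, nonZeroDivisors.ne_zero hc0, hcf, fun x => ⟨f x, ?_⟩⟩
  refine (LinearEquiv.symm_apply_eq e).mpr (Subtype.ext ?_)
  change c • f x = f (c • x)
  rw [map_smul]

/-- Over a domain, the normalized splitting numbers of `M` are asymptotic to those of a free module
of the same rank. -/
theorem abs_splittingRatio_sub_le [IsDomain A] (h : IsFFinite p A) (M : Type v) [AddCommGroup M]
    [Module A M] [Module.Finite A M] :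
    ∃ C : ℝ, ∀ e, |splittingRatio p A M e - Module.finrank A M * splittingRatio p A A e| ≤
      C * (1 / (p : ℝ)) ^ e := by
  obtain ⟨f, g, c, hc, hf, hg⟩ := exists_generic_isomorphism A M
  obtain ⟨C, hC⟩ := splittingRatio_le_add h f (mem_nonZeroDivisors_of_ne_zero hc) hf
  obtain ⟨C', hC'⟩ := splittingRatio_le_add h g (mem_nonZeroDivisors_of_ne_zero hc) hg
  refine ⟨max C C', fun e => ?_⟩
  have h1 := hC e
  have h2 := hC' e
  rw [splittingRatio_pi h] at h1 h2
  have hp : (0 : ℝ) ≤ (1 / (p : ℝ)) ^ e := by positivity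
  have h3 := mul_le_mul_of_nonneg_right (le_max_left C C') hp
  have h4 := mul_le_mul_of_nonneg_right (le_max_right C C') hp
  rw [abs_le]
  constructor <;> linarith

end Comparison

/-! ### Existence of the limit -/

/-- A bounded sequence with `s (e + 1) = t * s e + O(r ^ e)` for some `r < 1` converges: it is a
Cauchy sequence if `t = 1`, and tends to zero otherwise. -/
theorem exists_tendsto_of_abs_sub_le {s : ℕ → ℝ} {B C r t : ℝ} (ht : 0 ≤ t) (hr0 : 0 ≤ r)
    (hr : r < 1) (hB : ∀ e, |s e| ≤ B) (hs : ∀ e, |s (e + 1) - t * s e| ≤ C * r ^ e) :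
    ∃ l, Filter.Tendsto s Filter.atTop (nhds l) := by
  have hB0 : 0 ≤ B := (abs_nonneg _).trans (hB 0)
  have hC0 : 0 ≤ C := by simpa using (abs_nonneg _).trans (hs 0)
  rcases lt_trichotomy t 1 with h | rfl | h
  · -- the decay is geometric, at any rate `q < 1` above both `t` and `r`
    obtain ⟨q, hq, hq1⟩ := exists_between (max_lt h hr)
    have htq : t < q := (le_max_left _ _).trans_lt hq
    have hrq : r ≤ q := (le_max_right _ _).trans hq.le
    refine ⟨0, squeeze_zero_norm (a := fun e => max B (C / (q - t)) * q ^ e) (fun e => ?_) ?_⟩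
    · rw [Real.norm_eq_abs]
      set K := max B (C / (q - t))
      have hK : C ≤ K * (q - t) := by
        rw [← div_le_iff₀ (sub_pos.mpr htq)]
        exact le_max_right _ _
      induction e with
      | zero =>
        rw [pow_zero, mul_one]
        exact (hB 0).trans (le_max_left _ _)
      | succ e ih =>
        have h1 := abs_le.mp (hs e)
        have h2 : C * r ^ e ≤ C * q ^ e := by gcongr
        have h3 : |t * s e| ≤ t * (K * q ^ e) := by
          rw [abs_mul, abs_of_nonneg ht]
          gcongr
        have h4 : |s (e + 1)| ≤ |s (e + 1) - t * s e| + |t * s e| := by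
          simpa using abs_add_le (s (e + 1) - t * s e) (t * s e)
        have h5 : C * q ^ e ≤ K * (q - t) * q ^ e :=
          mul_le_mul_of_nonneg_right hK (pow_nonneg (ht.trans htq.le) e)
        have h6 := hs e
        rw [pow_succ]
        linarith
    · simpa using (tendsto_pow_atTop_nhds_zero_of_lt_one (ht.trans htq.le) hq1).const_mul
        (max B (C / (q - t)))
  · refine cauchySeq_tendsto_of_complete (cauchySeq_of_le_geometric r C hr fun e => ?_)
    rw [dist_comm, Real.dist_eq]
    simpa using hs e
  · -- going backwards from `e + n` to `e` contracts by `t ^ n`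
    have ht0 : 0 < t := one_pos.trans h
    have htr : 0 < t - r := by linarith
    have key : ∀ n e, |s e| ≤ C / (t - r) * r ^ e + B * (1 / t) ^ n := by
      intro n
      induction n with
      | zero =>
        intro e
        have : 0 ≤ C / (t - r) * r ^ e := by positivity
        have := hB e
        simp only [pow_zero, mul_one]
        linarith
      | succ n ih =>
        intro e
        have h1 := ih (e + 1)
        have h4 : |t * s e| ≤ |s (e + 1) - t * s e| + |s (e + 1)| := by
          have := abs_sub (s (e + 1)) (s (e + 1) - t * s e)
          rw [sub_sub_cancel] at this
          linarith
        rw [abs_mul, abs_of_pos ht0] at h4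
        have h6 := hs e
        have h7 : t * (C / (t - r) * r ^ e + B * (1 / t) ^ (n + 1)) =
            C / (t - r) * r ^ (e + 1) + C * r ^ e + B * (1 / t) ^ n := by
          have h8 : t * (1 / t) ^ (n + 1) = (1 / t) ^ n := by
            rw [pow_succ]
            field_simp
          have h9 : C / (t - r) * (t - r) = C := div_mul_cancel₀ C htr.ne'
          rw [mul_add, mul_left_comm t B, h8, pow_succ]
          linear_combination r ^ e * h9
        refine le_of_mul_le_mul_left ?_ ht0
        rw [h7]
        linarith
    refine ⟨0, squeeze_zero_norm (a := fun e => C / (t - r) * r ^ e) (fun e => ?_) ?_⟩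
    · rw [Real.norm_eq_abs]
      refine ge_of_tendsto' (f := fun n : ℕ => C / (t - r) * r ^ e + B * (1 / t) ^ n)
        (x := Filter.atTop) ?_ fun n => key n e
      have := (tendsto_pow_atTop_nhds_zero_of_lt_one (r := 1 / t) (by positivity)
        (by rw [div_lt_one ht0]; exact h)).const_mul B
      simpa using this.const_add (C / (t - r) * r ^ e)
    · simpa using (tendsto_pow_atTop_nhds_zero_of_lt_one hr0 hr).const_mul (C / (t - r))

section Limit

variable {p : ℕ} [Fact p.Prime]

theorem tendsto_one_div_pow : Filter.Tendsto (fun e : ℕ => (1 / (p : ℝ)) ^ e) Filter.atTop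
    (nhds 0) := by
  have hp : (1 : ℝ) < p := by exact_mod_cast (Fact.out : p.Prime).one_lt
  refine tendsto_pow_atTop_nhds_zero_of_lt_one (by positivity) ?_
  rw [div_lt_one (by linarith)]
  exact hp

variable {A : Type u} [CommRing A] [IsLocalRing A] [CharP A p]

theorem fSignatureExists_of_tendsto {l : ℝ}
    (h : Filter.Tendsto (fSplittingRatio p A) Filter.atTop (nhds l)) :
    FSignatureExists p A ∧ fSignature p A = l := by
  have h1 : fSignature p A = l := h.limUnder_eq
  exact ⟨by rw [FSignatureExists, h1]; exact h, h1⟩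

variable [IsNoetherianRing A]

/-- The `F`-signature of a domain exists: compare `F_* A` with a free module of the same rank. -/
theorem fSignatureExists_of_isDomain [IsDomain A] (h : IsFFinite p A) : FSignatureExists p A := by
  have hp : (1 : ℝ) < p := by exact_mod_cast (Fact.out : p.Prime).one_lt
  have hD := frobRank_pos h
  have := FrobPush.finite (M := A) h 1
  obtain ⟨C, hC⟩ := abs_splittingRatio_sub_le h (FrobPush p 1 A)
  obtain ⟨B, hB⟩ := splittingRatio_bounded h A
  have hsucc : ∀ e, splittingRatio p A (FrobPush p 1 A) e =
      frobRank p A * splittingRatio p A A (e + 1) := by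
    intro e
    unfold splittingRatio
    rw [freeRank_congr (FrobPush.compEquiv p 1 e A), add_comm 1 e, pow_succ]
    field_simp
  obtain ⟨l, hl⟩ := exists_tendsto_of_abs_sub_le (s := splittingRatio p A A) (B := B)
    (C := C / frobRank p A) (r := 1 / p)
    (t := Module.finrank A (FrobPush p 1 A) / frobRank p A) (by positivity) (by positivity)
    (by rw [div_lt_one (by linarith)]; exact hp)
    (fun e => by rw [abs_of_nonneg (splittingRatio_nonneg h A e)]; exact hB e) (fun e => by
      have h1 := hC e
      rw [hsucc] at h1
      rw [div_mul_eq_mul_div, div_mul_eq_mul_div, le_div_iff₀ hD, ← abs_of_pos hD, ← abs_mul,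
        abs_of_pos hD]
      rwa [sub_mul, div_mul_cancel₀ _ hD.ne', mul_comm (splittingRatio p A A (e + 1))])
  exact (fSignatureExists_of_tendsto hl).1

theorem tendsto_splittingRatio_of_isDomain [IsDomain A] (h : IsFFinite p A) (M : Type v)
    [AddCommGroup M] [Module A M] [Module.Finite A M] :
    Filter.Tendsto (splittingRatio p A M) Filter.atTop
      (nhds (Module.finrank A M * fSignature p A)) := by
  obtain ⟨C, hC⟩ := abs_splittingRatio_sub_le h M
  have h1 : Filter.Tendsto
      (fun e => splittingRatio p A M e - Module.finrank A M * splittingRatio p A A e)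
      Filter.atTop (nhds 0) :=
    squeeze_zero_norm hC (by simpa using tendsto_one_div_pow.const_mul C)
  have h2 : Filter.Tendsto (splittingRatio p A A) Filter.atTop (nhds (fSignature p A)) :=
    fSignatureExists_of_isDomain h
  simpa using h1.add (h2.const_mul (Module.finrank A M : ℝ))

/-- A reduced local ring that is not a domain has a nonzerodivisor that splits off no Frobenius
pushforward. For nonzero `u` with nonzero annihilator, the ideal `(u) + ann u` contains a
nonzerodivisor, and a form `F^e_* M → A` sends multiples of `u` into `ann (ann u)`, and multiples of
elements of `ann u` into `ann u`. -/
theorem exists_nonZeroDivisor_not_split [IsReduced A] (hA : ¬ IsDomain A) :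
    ∃ c ∈ nonZeroDivisors A, ∀ (M : Type v) [AddCommGroup M] [Module A M] (e : ℕ)
      (φ : FrobPush p e M →ₗ[A] A) (x : M), φ (FrobPush.of p e (c • x)) ∈ maximalIdeal A := by
  obtain ⟨u, v, huv, hu, hv⟩ : ∃ u v : A, u * v = 0 ∧ u ≠ 0 ∧ v ≠ 0 := by
    by_contra! hcon
    refine hA ((isDomain_iff_noZeroDivisors_and_nontrivial A).mpr ⟨⟨fun {a b} hab => ?_⟩,
      inferInstance⟩)
    by_contra! hne
    exact hne.2 (hcon a b hab hne.1)
  let K : Ideal A := Ideal.span {u} ⊔ LinearMap.ker (LinearMap.mulLeft A u)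
  obtain ⟨c, hcK, hc⟩ : ∃ c ∈ K, c ∈ nonZeroDivisors A := by
    -- otherwise `K` is contained in an associated prime `ann z`, and `z ^ 2 = 0`
    by_contra! hcon
    have hfin := associatedPrimes.finite A A
    have hsub : (K : Set A) ⊆ ⋃ i ∈ (hfin.toFinset : Set (Ideal A)), (i : Set A) := by
      intro x hx
      have := hcon x hx
      have h1 : x ∈ (nonZeroDivisors A : Set A)ᶜ := this
      rw [← biUnion_associatedPrimes_eq_compl_nonZeroDivisors] at h1
      simpa using h1
    obtain ⟨P, hP, hKP⟩ := (Ideal.subset_union_prime ⊥ ⊥ fun P hP _ _ =>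
      IsAssociatedPrime.isPrime (hfin.mem_toFinset.mp hP)).mp hsub
    obtain ⟨hPp, z, hz⟩ := isAssociatedPrime_iff.mp (hfin.mem_toFinset.mp hP)
    have hKz : ∀ x ∈ K, x * z = 0 := fun x hx => by
      have := hKP hx
      rw [hz, Submodule.mem_colon_singleton] at this
      exact this
    have hzz : z * z = 0 := hKz z <| Ideal.mem_sup_right <| LinearMap.mem_ker.mpr <|
      hKz u (Ideal.mem_sup_left (Ideal.mem_span_singleton_self u))
    have hz0 : z = 0 := IsReduced.eq_zero z ⟨2, by rw [pow_two, hzz]⟩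
    refine hPp.ne_top ((Ideal.eq_top_iff_one P).mpr ?_)
    rw [hz, hz0, Submodule.mem_colon_singleton, smul_zero]
    exact zero_mem _
  refine ⟨c, hc, fun M _ _ e φ x => ?_⟩
  -- an element killed by a nonzero element is not a unit
  have hmem : ∀ {a b : A}, a * b = 0 → a ≠ 0 → b ∈ maximalIdeal A := fun {a b} hab ha =>
    (IsLocalRing.mem_maximalIdeal b).mpr fun hb => ha (hb.mul_left_eq_zero.mp hab)
  have hmul : ∀ (a b : A), a * b = 0 → a * φ (FrobPush.of p e (b • x)) = 0 := fun a b hab => by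
    rw [← smul_eq_mul, ← map_smul, FrobPush.smul_of, smul_smul]
    have hq : a ^ p ^ e * b = 0 := by
      obtain ⟨n, hn⟩ := Nat.exists_eq_succ_of_ne_zero (pow_pos (Fact.out : p.Prime).pos e).ne'
      rw [hn, pow_succ, mul_assoc, hab, mul_zero]
    rw [hq, zero_smul, map_zero, map_zero]
  obtain ⟨b, hb, w, hw, rfl⟩ := Submodule.mem_sup.mp hcK
  obtain ⟨r, rfl⟩ := Ideal.mem_span_singleton'.mp hb
  rw [add_smul, map_add, map_add]
  exact add_mem (hmem (hmul v (r * u) (by rw [mul_left_comm, mul_comm v, huv, mul_zero])) hv)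
    (hmem (hmul u w hw) hu)

/-- Over a local ring that is not a domain, all normalized splitting numbers tend to zero. -/
theorem tendsto_splittingRatio_of_not_isDomain (hA : ¬ IsDomain A) (h : IsFFinite p A) (M : Type v)
    [AddCommGroup M] [Module A M] [Module.Finite A M] :
    Filter.Tendsto (splittingRatio p A M) Filter.atTop (nhds 0) := by
  have hfin := fun e => FrobPush.finite (M := M) h e
  by_cases hred : IsReduced A
  · -- as `F^e_* (c M)` lies in `nonSplit`, the free rank is at most the number of generators of
    -- `F^e_* (M / c M)`
    obtain ⟨c, hc, hcM⟩ := exists_nonZeroDivisor_not_split.{u, v} (p := p) hA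
    let P : Submodule A M := LinearMap.range (LinearMap.lsmul A M c)
    obtain ⟨C, hC⟩ := exists_frobPush_generators_le_of_smul_eq_zero h (M ⧸ P) hc fun x => by
      obtain ⟨x, rfl⟩ := Submodule.Quotient.mk_surjective _ x
      exact (Submodule.Quotient.mk_eq_zero _).mpr ⟨x, rfl⟩
    refine squeeze_zero (fun e => splittingRatio_nonneg h M e) (fun e => ?_)
      (by simpa using (tendsto_one_div_pow (p := p)).const_mul (C : ℝ))
    have := FrobPush.finite (M := M ⧸ P) h e
    have hle : LinearMap.ker (FrobPush.map p e P.mkQ) ≤ nonSplit A (FrobPush p e M) := by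
      intro x hx
      obtain ⟨y, hy⟩ := (Submodule.Quotient.mk_eq_zero P).mp hx
      intro φ
      have := hcM M e φ y
      rwa [show FrobPush.of p e (c • y) = x from hy] at this
    let k : FrobPush p e (M ⧸ P) →ₗ[A] FrobPush p e M ⧸ nonSplit A (FrobPush p e M) :=
      Submodule.factor hle ∘ₗ ((FrobPush.map p e P.mkQ).quotKerEquivOfSurjective
        (FrobPush.map_surjective e P.mkQ_surjective)).symm.toLinearMap
    have hks : Function.Surjective k :=
      (Submodule.factor_surjective hle).comp (LinearEquiv.surjective _)
    have hk : maximalIdeal A • (⊤ : Submodule A (FrobPush p e (M ⧸ P))) ≤ LinearMap.ker k := by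
      rw [Submodule.smul_le]
      intro r hr n _
      obtain ⟨y, hy⟩ := Submodule.Quotient.mk_surjective _ (k n)
      rw [LinearMap.mem_ker, map_smul, ← hy, ← Submodule.Quotient.mk_smul,
        Submodule.Quotient.mk_eq_zero]
      exact maximalIdeal_smul_le_nonSplit (Submodule.smul_mem_smul hr trivial)
    obtain ⟨l, hl⟩ := ENat.ne_top_iff_exists.mp (length_quotient_smul_top_ne_top (A := A)
      (N := FrobPush p e (M ⧸ P)))
    have h1 : (freeRank A (FrobPush p e M) : ℕ∞) ≤ l := by
      rw [freeRank_eq_length, hl]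
      exact Module.length_le_of_surjective (Submodule.liftQ _ k hk)
        fun y => (hks y).imp' Submodule.Quotient.mk fun x hx => hx
    have h2 := hC e
    rw [← hl] at h2
    unfold splittingRatio
    simpa using le_div_of_generators_le h (a := freeRank A (FrobPush p e M)) (b := 0) (l := l)
      (by rw [zero_add]; exact_mod_cast h1) (by exact_mod_cast h2)
  · -- a nilpotent element kills `F^e_* M` for large `e`, so `F^e_* M` has no free summand
    obtain ⟨x, ⟨n, hn⟩, hx⟩ : ∃ x : A, IsNilpotent x ∧ x ≠ 0 := by
      by_contra! hcon
      exact hred ⟨hcon⟩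
    refine tendsto_const_nhds.congr' ?_
    filter_upwards [Filter.eventually_ge_atTop n] with e he
    have htop : nonSplit A (FrobPush p e M) = ⊤ := by
      refine eq_top_iff.mpr fun m _ φ => (IsLocalRing.mem_maximalIdeal _).mpr fun hu => hx ?_
      have h1 : x • m = 0 := by
        change x ^ p ^ e • (FrobPush.of p e).symm m = 0
        rw [pow_eq_zero_of_le (he.trans (Nat.lt_pow_self (Fact.out : p.Prime).one_lt).le) hn,
          zero_smul]
      have h2 : x * φ m = 0 := by rw [← smul_eq_mul, ← map_smul, h1, map_zero]
      exact hu.mul_left_eq_zero.mp h2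
    have h0 : (freeRank A (FrobPush p e M) : ℕ∞) = 0 := by
      rw [freeRank_eq_length, htop]
      exact Module.length_eq_zero
    unfold splittingRatio
    rw [show freeRank A (FrobPush p e M) = 0 by exact_mod_cast h0, Nat.cast_zero, zero_div]

end Limit

/-! ### Invariants of finite local extensions -/

section Extension

theorem ringKrullDim_eq_of_isIntegral {A : Type u} {B : Type v} [CommRing A] [CommRing B]
    [Algebra A B] [Algebra.IsIntegral A B] (hinj : Function.Injective (algebraMap A B)) :
    ringKrullDim B = ringKrullDim A := by
  refine le_antisymm (Order.krullDim_le_of_strictMono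
    (PrimeSpectrum.comap (algebraMap A B)) fun P Q h => ?_) ?_
  · exact Ideal.IsIntegral.comap_lt_comap (R := A) h
  · -- lift chains of primes one step at a time by going up
    have key : ∀ l : LTSeries (PrimeSpectrum A), ∃ l' : LTSeries (PrimeSpectrum B),
        l'.length = l.length ∧ PrimeSpectrum.comap (algebraMap A B) l'.last = l.last := by
      intro l
      induction l using RelSeries.inductionOn' with
      | singleton P =>
        obtain ⟨Q, -, hQ, hQP⟩ := Ideal.exists_ideal_over_prime_of_isIntegral P.asIdeal
          (⊥ : Ideal B) (by
            rw [← RingHom.ker_eq_comap_bot, (RingHom.injective_iff_ker_eq_bot _).mp hinj]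
            exact bot_le)
        exact ⟨RelSeries.singleton _ ⟨Q, hQ⟩, rfl, PrimeSpectrum.ext hQP⟩
      | snoc l P hP ih =>
        obtain ⟨l', hl', hlast⟩ := ih
        have hlt : l.last < P := hP
        rw [← hlast] at hlt
        obtain ⟨Q, hQ, hQp, hQP⟩ := Ideal.exists_ideal_over_prime_of_isIntegral P.asIdeal
          l'.last.asIdeal hlt.le
        have hne : l'.last < ⟨Q, hQp⟩ := by
          refine lt_of_le_of_ne hQ fun h => hlt.ne ?_
          rw [h]
          exact PrimeSpectrum.ext hQP
        refine ⟨l'.snoc ⟨Q, hQp⟩ hne, ?_, ?_⟩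
        · simp [hl']
        · simp only [RelSeries.last_snoc]
          exact PrimeSpectrum.ext hQP
    unfold ringKrullDim Order.krullDim
    refine iSup_le fun l => ?_
    obtain ⟨l', hl', -⟩ := key l
    rw [← hl']
    exact le_iSup (fun l : LTSeries (PrimeSpectrum B) => (l.length : WithBot ℕ∞)) l'

variable {A : Type u} {B : Type v} [CommRing A] [CommRing B] [IsLocalRing A] [IsLocalRing B]
  [Algebra A B] [IsLocalHom (algebraMap A B)]

theorem length_residueField_of_finite [Module.Finite A B] :
    Module.length A (ResidueField B) = Module.finrank (ResidueField A) (ResidueField B) := by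
  have : Module.Finite (ResidueField A) (ResidueField B) :=
    Module.Finite.of_restrictScalars_finite A _ _
  rw [Module.length_eq_of_surjective (R := ResidueField A) residue_surjective,
    Module.length_eq_finrank]

theorem finrank_residueField_pos [Module.Finite A B] :
    0 < Module.finrank (ResidueField A) (ResidueField B) := by
  have : Module.Finite (ResidueField A) (ResidueField B) :=
    Module.Finite.of_restrictScalars_finite A _ _
  exact Module.finrank_pos

/-- Lengths over `A` and over `B` differ by the degree of the residue field extension. -/
theorem length_eq_finrank_mul_length [Module.Finite A B] {N : Type w} [AddCommGroup N] [Module B N]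
    (hN : IsFiniteLength B N) : ∀ [Module A N] [IsScalarTower A B N],
      Module.length A N =
        Module.finrank (ResidueField A) (ResidueField B) * Module.length B N := by
  induction hN with
  | of_subsingleton =>
    intro _ _
    rw [Module.length_eq_zero, Module.length_eq_zero, mul_zero]
  | @of_simple_quotient M _ _ N hs hN ih =>
    intro _ _
    obtain ⟨I, hI, ⟨e⟩⟩ := isSimpleModule_iff_quot_maximal.mp hs
    obtain rfl := IsLocalRing.eq_maximalIdeal hI
    have h1 : Module.length A (M ⧸ N) =
        Module.finrank (ResidueField A) (ResidueField B) := by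
      rw [(e.restrictScalars A).length_eq]
      exact length_residueField_of_finite
    rw [Module.length_eq_add_of_exact N.subtype N.mkQ (Submodule.subtype_injective _)
        (Submodule.mkQ_surjective _) (LinearMap.exact_subtype_mkQ _),
        Module.length_eq_one B (M ⧸ N),
        Module.length_eq_add_of_exact (N.subtype.restrictScalars A) (N.mkQ.restrictScalars A)
        (Submodule.subtype_injective N)
        (Submodule.mkQ_surjective N) (LinearMap.exact_subtype_mkQ N), mul_add, mul_one, ih, h1]

variable {p : ℕ} [Fact p.Prime] [CharP A p] [CharP B p]

instance (e : ℕ) : IsScalarTower A B (FrobPush p e B) :=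
  ⟨fun a b (x : B) => by
    change (a • b) ^ p ^ e * x = (a ^ p ^ e) • (b ^ p ^ e * x)
    rw [Algebra.smul_def, Algebra.smul_def, mul_pow, map_pow, mul_assoc]⟩

end Extension

theorem IsFFinite.of_finite_frobPush {p : ℕ} {A : Type u} [CommRing A] [ExpChar A p]
    (h : Module.Finite A (FrobPush p 1 A)) : IsFFinite p A := by
  obtain ⟨s, hs⟩ := h
  refine @Module.Finite.of_fg_top A A _ _ (frobenius A p).toAlgebra.toModule
    ⟨s.map (FrobPush.of p 1).symm.toEquiv.toEmbedding, ?_⟩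
  rw [eq_top_iff]
  intro x _
  have hx : FrobPush.of p 1 x ∈ (⊤ : Submodule A (FrobPush p 1 A)) := trivial
  rw [← hs] at hx
  refine Submodule.span_induction
    (p := fun y _ => (FrobPush.of p 1).symm y ∈
      @Submodule.span A A _ _ (frobenius A p).toAlgebra.toModule
        (s.map (FrobPush.of p 1).symm.toEquiv.toEmbedding : Set A)) ?_ ?_ ?_ ?_ hx
  · exact fun y hy => @Submodule.subset_span A A _ _ (frobenius A p).toAlgebra.toModule _ _
      (Finset.mem_map_of_mem _ hy)
  · exact zero_mem _
  · exact fun y z _ _ hy hz => add_mem hy hz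
  · intro a y _ hy
    have h1 := @Submodule.smul_mem A A _ _ (frobenius A p).toAlgebra.toModule _ _ a hy
    convert h1 using 1
    change a ^ p ^ 1 * (FrobPush.of p 1).symm y = a ^ p * (FrobPush.of p 1).symm y
    rw [pow_one]

section Extension

variable {A : Type u} {B : Type v} [CommRing A] [CommRing B]
  [Algebra A B] {p : ℕ} [Fact p.Prime] [CharP A p] [CharP B p]

theorem IsFFinite.of_finite (h : IsFFinite p A) [Module.Finite A B] : IsFFinite p B := by
  have := FrobPush.finite (M := B) h 1
  exact .of_finite_frobPush (Module.Finite.of_restrictScalars_finite A B _)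

theorem IsFFinite.of_surjective (h : IsFFinite p B) [Module.Finite A B] {T : B →ₗ[A] A}
    (hs : Function.Surjective T) : IsFFinite p A := by
  have := FrobPush.finite_self h
  have : Module.Finite A (FrobPush p 1 B) := Module.Finite.trans B _
  exact .of_finite_frobPush (Module.Finite.of_surjective _ (FrobPush.map_surjective 1 hs))

variable [IsLocalRing A] [IsLocalRing B] [IsLocalHom (algebraMap A B)]

theorem residueFrobDegree_eq (h : IsFFinite p A) [Module.Finite A B] :
    residueFrobDegree p B = residueFrobDegree p A := by
  have hn := finrank_residueField_pos (A := A) (B := B)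
  set n := Module.finrank (ResidueField A) (ResidueField B) with hn_def
  have : Module.Finite (ResidueField A) (ResidueField B) :=
    Module.Finite.of_restrictScalars_finite A _ _
  have hB := IsFFinite.of_finite (B := B) h
  have : IsScalarTower A B (FrobPush p 1 (ResidueField B)) :=
    ⟨fun a b (x : ResidueField B) => by
      change (a • b) ^ p ^ 1 • x = (a ^ p ^ 1) • (b ^ p ^ 1 • x)
      rw [smul_pow, smul_assoc]⟩
  have h1 : Module.length A (FrobPush p 1 (ResidueField B)) = n * residueFrobDegree p B := by
    rw [← length_frobPush_residueField hB]
    refine length_eq_finrank_mul_length (Module.length_ne_top_iff.mp ?_)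
    rw [length_frobPush_residueField hB]
    exact ENat.natCast_ne_top _
  have h2 : Module.length A (FrobPush p 1 (ResidueField B)) = n * residueFrobDegree p A := by
    rw [(FrobPush.congr p 1 ((Module.finBasis (ResidueField A)
      (ResidueField B)).equivFun.restrictScalars A)).length_eq,
      (FrobPush.piEquiv p 1 (ResidueField A) (Fin n)).length_eq, Module.length_pi,
      length_frobPush_residueField h, ENat.card_eq_coe_fintype_card, Fintype.card_fin]
  rw [h1] at h2
  have h3 : n * residueFrobDegree p B = n * residueFrobDegree p A := by exact_mod_cast h2
  exact Nat.eq_of_mul_eq_mul_left hn h3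

theorem frobRank_eq (h : IsFFinite p A) [Module.Finite A B]
    (hinj : Function.Injective (algebraMap A B)) : frobRank p B = frobRank p A := by
  unfold frobRank dimNat
  rw [residueFrobDegree_eq (A := A) h, ringKrullDim_eq_of_isIntegral hinj]

end Extension

/-! ### The transformation rule -/

section Transformation

variable {A : Type u} {B : Type v} [CommRing A] [CommRing B] [Algebra A B] {T : B →ₗ[A] A}

/-- If `T` generates `Hom_A(B, A)`, every `A`-linear form on a `B`-module factors through `T`. -/
theorem FreelyGeneratesDual.exists_comp_eq (hT : FreelyGeneratesDual T) {N : Type w}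
    [AddCommGroup N] [Module A N] [Module B N] [IsScalarTower A B N] (φ : N →ₗ[A] A) :
    ∃ ψ : N →ₗ[B] B, ∀ n, φ n = T (ψ n) := by
  have hex : ∀ n : N, ∃ c : B, ∀ b : B, T (c * b) = φ (b • n) := fun n => by
    obtain ⟨c, hc⟩ := hT.2 (φ ∘ₗ (LinearMap.toSpanSingleton B N n).restrictScalars A)
    exact ⟨c, fun b => LinearMap.congr_fun hc b⟩
  choose c hc using hex
  have huniq : ∀ {x y : B}, (∀ b, T (x * b) = T (y * b)) → x = y := fun {x y} hxy =>
    hT.1 (LinearMap.ext hxy)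
  refine ⟨⟨⟨c, fun m n => huniq fun b => ?_⟩, fun r n => huniq fun b => ?_⟩, fun n => ?_⟩
  · rw [add_mul, map_add, hc, hc, hc, smul_add, map_add]
  · rw [RingHom.id_apply, smul_eq_mul, mul_assoc, mul_left_comm, hc, hc, smul_smul, mul_comm]
  · have := hc n 1
    rw [one_smul, mul_one] at this
    exact this.symm

variable [IsLocalRing A] [IsLocalRing B]

theorem nonSplit_le_of_surjective (hs : Function.Surjective T) (N : Type w) [AddCommGroup N]
    [Module A N] [Module B N] [IsScalarTower A B N] :
    nonSplit A N ≤ (nonSplit B N).restrictScalars A := by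
  intro x hx ψ
  refine (IsLocalRing.mem_maximalIdeal _).mpr fun hu => ?_
  obtain ⟨u, hu⟩ := hu.exists_left_inv
  obtain ⟨b, hb⟩ := hs 1
  have := hx (T ∘ₗ ((b * u) • ψ).restrictScalars A)
  refine (IsLocalRing.mem_maximalIdeal _).mp this ?_
  rw [LinearMap.comp_apply, LinearMap.restrictScalars_apply, LinearMap.smul_apply, smul_eq_mul,
    mul_assoc, hu, mul_one, hb]
  exact isUnit_one

theorem nonSplit_eq_of_freelyGeneratesDual (hT : FreelyGeneratesDual T)
    (hs : Function.Surjective T) (hm : ∀ b ∈ maximalIdeal B, T b ∈ maximalIdeal A) (N : Type w)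
    [AddCommGroup N] [Module A N] [Module B N] [IsScalarTower A B N] :
    nonSplit A N = (nonSplit B N).restrictScalars A := by
  refine le_antisymm (nonSplit_le_of_surjective hs N) fun x hx φ => ?_
  obtain ⟨ψ, hψ⟩ := hT.exists_comp_eq φ
  rw [hψ]
  exact hm _ (hx ψ)

variable [IsLocalHom (algebraMap A B)] [Module.Finite A B]

theorem length_quotient_nonSplit_restrictScalars (N : Type w) [AddCommGroup N]
    [Module A N] [Module B N] [IsScalarTower A B N] [Module.Finite B N] :
    Module.length A (N ⧸ (nonSplit B N).restrictScalars A) =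
      Module.finrank (ResidueField A) (ResidueField B) * freeRank B N := by
  rw [freeRank_eq_length]
  rw [(Submodule.Quotient.restrictScalarsEquiv A (nonSplit B N)).length_eq]
  exact length_eq_finrank_mul_length (N := N ⧸ nonSplit B N)
    (Module.length_ne_top_iff.mp length_quotient_nonSplit_ne_top)

theorem freeRank_eq_finrank_mul (hT : FreelyGeneratesDual T)
    (hs : Function.Surjective T) (hm : ∀ b ∈ maximalIdeal B, T b ∈ maximalIdeal A) (N : Type w)
    [AddCommGroup N] [Module A N] [Module B N] [IsScalarTower A B N] [Module.Finite A N]  :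
    freeRank A N = Module.finrank (ResidueField A) (ResidueField B) * freeRank B N := by
  have := Module.Finite.of_restrictScalars_finite A B N
  have h := length_quotient_nonSplit_restrictScalars (A := A) (B := B) N
  rw [← nonSplit_eq_of_freelyGeneratesDual hT hs hm, ← freeRank_eq_length] at h
  exact_mod_cast h

theorem freeRank_le_of_surjective (hs : Function.Surjective T) (N : Type w)
    [AddCommGroup N] [Module A N] [Module B N] [IsScalarTower A B N] [Module.Finite A N]  :
    freeRank B N ≤ freeRank A N := by
  have := Module.Finite.of_restrictScalars_finite A B N
  have h := length_quotient_nonSplit_restrictScalars (A := A) (B := B) N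
  have h1 : Module.finrank (ResidueField A) (ResidueField B) * freeRank B N ≤ freeRank A N := by
    have h2 := Module.length_le_of_surjective _
      (Submodule.factor_surjective (nonSplit_le_of_surjective hs N))
    rw [h, ← freeRank_eq_length] at h2
    exact_mod_cast h2
  exact (Nat.le_mul_of_pos_left _ finrank_residueField_pos).trans h1

variable {p : ℕ} [Fact p.Prime] [CharP A p] [CharP B p] [IsNoetherianRing A]

/-- If `A` is not a domain and some form `B → A` is surjective, both `F`-signatures vanish. -/
theorem fSignature_eq_zero_of_not_isDomain (hA : ¬ IsDomain A) (h : IsFFinite p A)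
    (hinj : Function.Injective (algebraMap A B)) (hs : Function.Surjective T) :
    (FSignatureExists p A ∧ fSignature p A = 0) ∧ (FSignatureExists p B ∧ fSignature p B = 0) := by
  refine ⟨fSignatureExists_of_tendsto (tendsto_splittingRatio_of_not_isDomain hA h A),
    fSignatureExists_of_tendsto (squeeze_zero (splittingRatio_nonneg (h.of_finite (B := B)) B)
      (fun e => ?_) (tendsto_splittingRatio_of_not_isDomain hA h B))⟩
  have := FrobPush.finite (M := B) h e
  change splittingRatio p B B e ≤ _
  unfold splittingRatio
  rw [frobRank_eq h hinj]
  have := freeRank_le_of_surjective hs (FrobPush p e B)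
  have := pow_pos (frobRank_pos h) e
  gcongr

/-- The transformation rule for `F`-signatures over a domain: the splitting numbers of `F^e_* B`
over `A` are those over `B` up to the degree of the residue fields, and are asymptotic to those of a
free `A`-module of the rank of `B`. -/
theorem fSignature_transformation_of_isDomain [IsDomain A] (h : IsFFinite p A)
    (hinj : Function.Injective (algebraMap A B)) (hT : FreelyGeneratesDual T)
    (hs : Function.Surjective T) (hm : ∀ b ∈ maximalIdeal B, T b ∈ maximalIdeal A) :
    FSignatureExists p B ∧
      (Module.finrank (ResidueField A) (ResidueField B) : ℝ) * fSignature p B =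
        Module.finrank A B * fSignature p A := by
  have hn : (0 : ℝ) < Module.finrank (ResidueField A) (ResidueField B) := by
    exact_mod_cast finrank_residueField_pos (A := A) (B := B)
  set n : ℝ := (Module.finrank (ResidueField A) (ResidueField B) : ℝ)
  have key : ∀ e, splittingRatio p A B e / n = fSplittingRatio p B e := fun e => by
    have := FrobPush.finite (M := B) h e
    rw [← splittingRatio_self, div_eq_iff hn.ne']
    unfold splittingRatio
    rw [freeRank_eq_finrank_mul hT hs hm, frobRank_eq h hinj, Nat.cast_mul]
    ring
  obtain ⟨h1, h2⟩ := fSignatureExists_of_tendsto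
    (((tendsto_splittingRatio_of_isDomain h B).div_const n).congr key)
  refine ⟨h1, ?_⟩
  rw [h2, mul_div_cancel₀ _ hn.ne']

end Transformation

/-! ### Strong `F`-regularity -/

section StrongFRegularity

variable {p : ℕ} [Fact p.Prime] {A : Type u} [CommRing A] [IsLocalRing A] [IsNoetherianRing A]
  [CharP A p]

theorem IsStronglyFRegular.isDomain (h : IsStronglyFRegular p A) : IsDomain A := by
  have hred : IsReduced A := by
    rw [isReduced_iff_pow_one_lt 2 one_lt_two]
    intro x hx
    obtain ⟨e, he, φ, hφ⟩ := h 1 fun P hP h1 => hP.1.1.ne_top ((Ideal.eq_top_iff_one P).mpr h1)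
    have h1 : x * φ (FrobPush.of p e 1) = 0 := by
      have hp : 2 ≤ p ^ e := (Fact.out : p.Prime).two_le.trans (Nat.le_self_pow he.ne' p)
      rw [← smul_eq_mul, ← map_smul, FrobPush.smul_of, pow_eq_zero_of_le hp hx, zero_smul,
        map_zero, map_zero]
    rwa [hφ, mul_one] at h1
  by_contra hA
  obtain ⟨c, hc, hcA⟩ := exists_nonZeroDivisor_not_split.{u, u} (p := p) hA
  obtain ⟨e, -, φ, hφ⟩ := h c fun P hP hcP =>
    Set.disjoint_left.mp (Ideal.disjoint_nonZeroDivisors_of_mem_minimalPrimes hP) hcP hc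
  have h1 := hcA A e φ 1
  rw [smul_eq_mul, mul_one, hφ] at h1
  exact (IsLocalRing.mem_maximalIdeal _).mp h1 isUnit_one

end StrongFRegularity

section StrongFRegularity

variable {p : ℕ} [Fact p.Prime] {A : Type u} [CommRing A] [IsNoetherianRing A] [CharP A p]
  {B : Type v} [CommRing B] [IsLocalRing B] [CharP B p] [Algebra A B] [Module.Finite A B]
  {T : B →ₗ[A] A}

theorem IsStronglyFRegular.of_base [IsLocalRing A] (h : IsStronglyFRegular p A)
    (hT : FreelyGeneratesDual T) (hs : Function.Surjective T)
    (hm : ∀ b ∈ maximalIdeal B, T b ∈ maximalIdeal A) : IsStronglyFRegular p B := by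
  have := h.isDomain
  intro c hc
  -- `c` divides a nonzero element of `A`, as it lies in no prime over zero
  obtain ⟨a, b, ha, hab⟩ : ∃ (a : A) (b : B), a ≠ 0 ∧ b * c = algebraMap A B a := by
    by_contra! hcon
    have hbot : (Ideal.span {c}).comap (algebraMap A B) ≤ ⊥ := fun a ha => by
      obtain ⟨b, hb⟩ := Ideal.mem_span_singleton'.mp ha
      by_contra ha0
      exact hcon a b ha0 hb
    obtain ⟨Q, hcQ, hQ, hQA⟩ := Ideal.exists_ideal_over_prime_of_isIntegral (⊥ : Ideal A) _ hbot
    obtain ⟨P, hP, hPQ⟩ := Ideal.exists_minimalPrimes_le (J := Q) (bot_le (a := Q))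
    have := hP.1.1
    rcases hPQ.eq_or_lt with rfl | hlt
    · exact hc P hP (hcQ (Ideal.mem_span_singleton_self c))
    · have := Ideal.IsIntegral.comap_lt_comap (R := A) hlt
      rw [hQA] at this
      exact not_lt_bot this
  obtain ⟨e, he, φ, hφ⟩ := h a fun P hP haP => by
    rw [IsDomain.minimalPrimes_eq_singleton_bot, Set.mem_singleton_iff] at hP
    rw [hP] at haP
    exact ha haP
  obtain ⟨ψ, hψ⟩ := hT.exists_comp_eq (φ ∘ₗ FrobPush.map p e T)
  obtain ⟨d, hd⟩ := hs 1
  have h1 : T (ψ (FrobPush.of p e (a • d))) = 1 := by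
    rw [← hψ, LinearMap.comp_apply, FrobPush.map_of, map_smul, hd, smul_eq_mul, mul_one, hφ]
  have hu : IsUnit (ψ (FrobPush.of p e (a • d))) := by
    by_contra hu
    have := hm _ ((IsLocalRing.mem_maximalIdeal _).mpr hu)
    rw [h1] at this
    exact (IsLocalRing.mem_maximalIdeal _).mp this isUnit_one
  obtain ⟨r, hr⟩ := hu.exists_left_inv
  refine ⟨e, he, r • (ψ ∘ₗ FrobPush.map p e (LinearMap.mulLeft B (d * b))), ?_⟩
  rw [LinearMap.smul_apply, LinearMap.comp_apply, FrobPush.map_of, LinearMap.mulLeft_apply,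
    mul_assoc, hab, mul_comm d, ← Algebra.smul_def, smul_eq_mul, hr]

theorem IsStronglyFRegular.to_base (h : IsStronglyFRegular p B)
    (hinj : Function.Injective (algebraMap A B)) (hs : Function.Surjective T) :
    IsStronglyFRegular p A := by
  have : IsNoetherianRing B := IsNoetherianRing.of_finite A B
  have := h.isDomain
  have : IsDomain A := hinj.isDomain (algebraMap A B)
  intro c hc
  have hc0 : c ≠ 0 := fun h0 => hc ⊥ (by
    rw [IsDomain.minimalPrimes_eq_singleton_bot]; rfl) (by rw [h0]; exact zero_mem _)
  obtain ⟨e, he, ψ, hψ⟩ := h (algebraMap A B c) fun P hP hcP => by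
    rw [IsDomain.minimalPrimes_eq_singleton_bot, Set.mem_singleton_iff] at hP
    rw [hP, Ideal.mem_bot] at hcP
    exact hc0 ((map_eq_zero_iff _ hinj).mp hcP)
  obtain ⟨d, hd⟩ := hs 1
  refine ⟨e, he, T ∘ₗ (d • ψ).restrictScalars A ∘ₗ FrobPush.map p e (Algebra.linearMap A B), ?_⟩
  rw [LinearMap.comp_apply, LinearMap.comp_apply, FrobPush.map_of, Algebra.linearMap_apply,
    LinearMap.restrictScalars_apply, LinearMap.smul_apply, hψ, smul_eq_mul, mul_one, hd]

end StrongFRegularity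

/-! ### Integrals on finite commutative Hopf algebras -/

section Hopf

variable {k : Type u} {H : Type w} [Field k] [CommRing H] [HopfAlgebra k H]

/-- For an algebra map `g : H → W`, the `W`-algebra endomorphism `w ⊗ h ↦ (w ⊗ 1) (g ⊗ id) (Δ h)` of
`W ⊗ H`: the automorphism of `G × Spec W` over `Spec W` that translates by the point `g`. -/
noncomputable def translation {W : Type*} [CommRing W] [Algebra k W] (g : H →ₐ[k] W) :
    W ⊗[k] H →ₐ[W] W ⊗[k] H :=
  Algebra.TensorProduct.lift Algebra.TensorProduct.includeLeft
    ((Algebra.TensorProduct.map g (AlgHom.id k H)).comp (Bialgebra.comulAlgHom k H))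
    fun _ _ => Commute.all _ _

theorem translation_tmul {W : Type*} [CommRing W] [Algebra k W] (g : H →ₐ[k] W) (a : W) (h : H) :
    translation g (a ⊗ₜ h) =
      a ⊗ₜ 1 * Algebra.TensorProduct.map g (AlgHom.id k H) (Coalgebra.comul h) := by
  simp [translation]

/-- The antipode provides preimages under `translation`: `∑ g (S h₁) g h₂ ⊗ h₃ = 1 ⊗ h`. -/
theorem translation_antipode {W : Type*} [CommRing W] [Algebra k W] (g : H →ₐ[k] W) (h : H) :
    translation g ((g.toLinearMap ∘ₗ HopfAlgebra.antipode k).rTensor H (Coalgebra.comul h)) =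
      1 ⊗ₜ h := by
  have h1 : ∀ z : H ⊗[k] H,
      translation g ((g.toLinearMap ∘ₗ HopfAlgebra.antipode k).rTensor H z) =
      (g.toLinearMap ∘ₗ LinearMap.mul' k H ∘ₗ (HopfAlgebra.antipode k).rTensor H).rTensor H
        ((TensorProduct.assoc k H H H).symm (Coalgebra.comul.lTensor H z)) := by
    intro z
    induction z with
    | zero => simp
    | add x y hx hy => simp only [map_add, hx, hy]
    | tmul a b =>
      rw [LinearMap.rTensor_tmul, translation_tmul, LinearMap.lTensor_tmul]
      generalize (Coalgebra.comul b : H ⊗[k] H) = y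
      induction y with
      | zero => simp
      | add x y hx hy => simp only [map_add, mul_add, TensorProduct.tmul_add, hx, hy]
      | tmul c d => simp
  rw [h1, Coalgebra.coassoc_symm_apply, ← LinearMap.comp_apply, ← LinearMap.rTensor_comp,
    LinearMap.comp_assoc, LinearMap.comp_assoc, HopfAlgebra.mul_antipode_rTensor_comul,
    ← LinearMap.comp_assoc, LinearMap.rTensor_comp, LinearMap.comp_apply,
    Coalgebra.rTensor_counit_comul]
  simp

theorem translation_surjective {W : Type*} [CommRing W] [Algebra k W] (g : H →ₐ[k] W) :
    Function.Surjective (translation g) := by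
  intro z
  induction z with
  | zero => exact ⟨0, map_zero _⟩
  | add x y hx hy =>
    obtain ⟨a, rfl⟩ := hx
    obtain ⟨b, rfl⟩ := hy
    exact ⟨a + b, map_add _ _ _⟩
  | tmul w h =>
    refine ⟨w • ((g.toLinearMap ∘ₗ HopfAlgebra.antipode k).rTensor H (Coalgebra.comul h)), ?_⟩
    rw [map_smul, translation_antipode, TensorProduct.smul_tmul', smul_eq_mul, mul_one]

theorem translation_bijective [Module.Finite k H] {W : Type*} [CommRing W] [Algebra k W]
    (g : H →ₐ[k] W) : Function.Bijective (translation g) :=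
  OrzechProperty.bijective_of_surjective_endomorphism (translation g).toLinearMap
    (translation_surjective g)

/-- A nonzero left integral on a commutative Hopf algebra is nondegenerate. -/
theorem IsLeftIntegral.eq_zero_of_forall_mul {t : H →ₗ[k] k} (ht : IsLeftIntegral t) (ht0 : t ≠ 0)
    {h : H} (hh : ∀ x, t (h * x) = 0) : h = 0 := by
  -- the elements `h` with `t (h x) = 0` for all `x` form an ideal `N`
  have hN : ∀ h : H, (∀ x, t (h * x) = 0) → ∀ v : H ⊗[k] H,
      TensorProduct.rid k H (t.lTensor H (Coalgebra.comul h * v)) = 0 := by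
    intro h hh v
    obtain ⟨w, rfl⟩ := translation_surjective (AlgHom.id k H) v
    induction w with
    | zero => simp
    | add x y hx hy => simp only [map_add, mul_add, hx, hy, add_zero]
    | tmul a c =>
      have h1 : ∀ z : H ⊗[k] H, TensorProduct.rid k H (t.lTensor H ((a ⊗ₜ 1) * z)) =
          a * TensorProduct.rid k H (t.lTensor H z) := by
        intro z
        induction z with
        | zero => simp
        | add x y hx hy => simp only [map_add, mul_add, hx, hy]
        | tmul b d => simp
      rw [translation_tmul, Algebra.TensorProduct.map_id, AlgHom.id_apply, mul_left_comm, h1,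
        ← Bialgebra.comul_mul, ht.lTensor_comul, hh, zero_smul, mul_zero]
  -- `Δ N ⊆ H ⊗ N`, in terms of a basis of `H`
  have hrepr : ∀ h : H, (∀ x, t (h * x) = 0) → ∃ c : Module.Free.ChooseBasisIndex k H →₀ H,
      (∀ i x, t (c i * x) = 0) ∧
      c.sum (fun i m => Module.Free.chooseBasis k H i ⊗ₜ[k] m) = Coalgebra.comul h := by
    intro h hh
    obtain ⟨c, hc⟩ := TensorProduct.eq_repr_basis_left (Module.Free.chooseBasis k H)
      (Coalgebra.comul (R := k) h)
    refine ⟨c, fun i x => ?_, hc⟩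
    have h2 := hN h hh (1 ⊗ₜ x)
    rw [← hc, Finsupp.sum, Finset.sum_mul, map_sum, map_sum] at h2
    simp only [Algebra.TensorProduct.tmul_mul_tmul, mul_one, LinearMap.lTensor_tmul,
      TensorProduct.rid_tmul] at h2
    have h3 := linearIndependent_iff'.mp (Module.Free.chooseBasis k H).linearIndependent _ _ h2 i
    by_cases hi : i ∈ c.support
    · exact h3 hi
    · rw [Finsupp.notMem_support_iff.mp hi, zero_mul, map_zero]
  -- the counit vanishes on `N`, as otherwise `1 ∈ N`
  have hcounit : ∀ h : H, (∀ x, t (h * x) = 0) → Coalgebra.counit (R := k) h = 0 := by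
    intro h hh
    obtain ⟨c, hc, hsum⟩ := hrepr h hh
    by_contra hne
    apply ht0
    ext x
    have h4 := HopfAlgebra.mul_antipode_rTensor_comul_apply (R := k) h
    rw [← hsum, Finsupp.sum, map_sum, map_sum] at h4
    simp only [LinearMap.rTensor_tmul, LinearMap.mul'_apply] at h4
    have h5 : t (algebraMap k H (Coalgebra.counit h) * x) = 0 := by
      rw [← h4, Finset.sum_mul, map_sum]
      refine Finset.sum_eq_zero fun i _ => ?_
      rw [mul_comm (HopfAlgebra.antipode k _), mul_assoc, hc]
    rw [← Algebra.smul_def, map_smul, smul_eq_mul] at h5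
    simpa [hne] using h5
  obtain ⟨c, hc, hsum⟩ := hrepr h hh
  have h6 := Coalgebra.lTensor_counit_comul (R := k) h
  rw [← hsum, Finsupp.sum, map_sum] at h6
  simp only [LinearMap.lTensor_tmul, hcounit _ (hc _), TensorProduct.tmul_zero,
    Finset.sum_const_zero] at h6
  simpa using congrArg (TensorProduct.rid k H) h6.symm

/-- The counit is a multiple of a nonzero left integral. -/
theorem IsLeftIntegral.exists_counit_eq [Module.Finite k H] {t : H →ₗ[k] k}
    (ht : IsLeftIntegral t) (ht0 : t ≠ 0) :
    ∃ x : H, ∀ h : H, t (h * x) = Coalgebra.counit h := by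
  have hinj : Function.Injective ((LinearMap.mul k H).compr₂ t) := by
    rw [← LinearMap.ker_eq_bot, LinearMap.ker_eq_bot']
    exact fun h hh => ht.eq_zero_of_forall_mul ht0 fun x => LinearMap.congr_fun hh x
  obtain ⟨x, hx⟩ := (LinearMap.injective_iff_surjective_of_finrank_eq_finrank
    (Subspace.dual_finrank_eq (K := k) (V := H)).symm).mp hinj (Coalgebra.counit (R := k) (A := H))
  exact ⟨x, fun h => by rw [mul_comm]; exact LinearMap.congr_fun hx h⟩

end Hopf

/-! ### Characteristic polynomials of the coaction -/

section CharPoly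

variable {k : Type u} {H : Type w} [Field k] [CommRing H] [Algebra k H]

theorem basis_repr_map {S S' : Type*} [CommRing S] [Algebra k S] [CommRing S'] [Algebra k S']
    {ι : Type*} (b : Module.Basis ι k H) (f : S →ₐ[k] S') (z : S ⊗[k] H) (i : ι) :
    (Algebra.TensorProduct.basis S' b).repr
      (Algebra.TensorProduct.map f (AlgHom.id k H) z) i =
    f ((Algebra.TensorProduct.basis S b).repr z i) := by
  induction z with
  | zero => simp
  | add x y hx hy => simp only [map_add, Finsupp.add_apply, hx, hy]
  | tmul a h => simp [Algebra.TensorProduct.basis_repr_tmul]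

/-- Characteristic polynomials of elements of `S ⊗ H` commute with base change in `S`. -/
theorem charpoly_lmul_map [Module.Finite k H] {S S' : Type*} [CommRing S] [Algebra k S]
    [CommRing S'] [Algebra k S'] (f : S →ₐ[k] S') (z : S ⊗[k] H) :
    (Algebra.lmul S' (S' ⊗[k] H) (Algebra.TensorProduct.map f (AlgHom.id k H) z)).charpoly =
      (Algebra.lmul S (S ⊗[k] H) z).charpoly.map (f : S →+* S') := by
  classical
  let b := Module.Free.chooseBasis k H
  rw [← LinearMap.charpoly_toMatrix _ (Algebra.TensorProduct.basis S' b),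
    ← LinearMap.charpoly_toMatrix _ (Algebra.TensorProduct.basis S b), ← Matrix.charpoly_map]
  congr 1
  ext i j
  rw [Matrix.map_apply, LinearMap.toMatrix_apply, LinearMap.toMatrix_apply]
  simp only [Algebra.coe_lmul_eq_mul, LinearMap.mul_apply']
  rw [RingHom.coe_coe, ← basis_repr_map,
    map_mul (Algebra.TensorProduct.map f (AlgHom.id k H))]
  simp

end CharPoly

namespace GroupSchemeAction

variable {k : Type u} {S : Type v} {H : Type w} [Field k] [CommRing S] [Algebra k S] [CommRing H]
  [HopfAlgebra k H] (α : GroupSchemeAction k S H)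

theorem coact_injective : Function.Injective α.coact := fun a b h => by
  rw [← α.counit a, ← α.counit b, h]

/-- Coassociativity: the pullbacks of `α(s)` along the action and along the projection
`Spec S × G → Spec S` differ by a translation of `G`. -/
theorem map_coact_coact (s : S) :
    Algebra.TensorProduct.map α.coact (AlgHom.id k H) (α.coact s) =
      translation (Algebra.TensorProduct.includeRight : H →ₐ[k] S ⊗[k] H)
        (Algebra.TensorProduct.map (Algebra.TensorProduct.includeLeft : S →ₐ[k] S ⊗[k] H)
          (AlgHom.id k H) (α.coact s)) := by
  have h1 : ∀ z : S ⊗[k] H, Algebra.TensorProduct.map α.coact (AlgHom.id k H) z =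
      α.coact.toLinearMap.rTensor H z := fun z => by
    induction z with
    | zero => simp
    | add x y hx hy => simp only [map_add, hx, hy]
    | tmul a h => simp
  have h2 : ∀ z : S ⊗[k] H, translation (Algebra.TensorProduct.includeRight : H →ₐ[k] S ⊗[k] H)
        (Algebra.TensorProduct.map (Algebra.TensorProduct.includeLeft : S →ₐ[k] S ⊗[k] H)
          (AlgHom.id k H) z) =
      (TensorProduct.assoc k S H H).symm (Coalgebra.comul.lTensor S z) := fun z => by
    induction z with
    | zero => simp
    | add x y hx hy => simp only [map_add, hx, hy]
    | tmul a h =>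
      rw [Algebra.TensorProduct.map_tmul, translation_tmul, LinearMap.lTensor_tmul,
        AlgHom.id_apply]
      generalize (Coalgebra.comul h : H ⊗[k] H) = y
      induction y with
      | zero => simp
      | add x y hx hy => simp only [map_add, mul_add, TensorProduct.tmul_add, hx, hy]
      | tmul c d => simp
  rw [h1, h2, ← α.coassoc, LinearEquiv.symm_apply_apply]

theorem repr_coact_mem {ι : Type*} (b : Module.Basis ι k H) {I : Ideal α.invariants} {s : S}
    (hs : s ∈ I.map (algebraMap α.invariants S)) (i : ι) :
    (Algebra.TensorProduct.basis S b).repr (α.coact s) i ∈ I.map (algebraMap α.invariants S) := by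
  let J := I.map (algebraMap α.invariants S)
  let q := (Algebra.TensorProduct.map (Ideal.Quotient.mkₐ k J) (AlgHom.id k H)).comp α.coact
  have hq : J ≤ RingHom.ker q := by
    refine Ideal.map_le_iff_le_comap.mpr fun r hr => ?_
    change Algebra.TensorProduct.map (Ideal.Quotient.mkₐ k J) (AlgHom.id k H) (α.coact r) = 0
    rw [α.mem_invariants.mp r.2, Algebra.TensorProduct.map_tmul,
      show Ideal.Quotient.mkₐ k J r = 0 from
        Ideal.Quotient.eq_zero_iff_mem.mpr (Ideal.mem_map_of_mem _ hr), TensorProduct.zero_tmul]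
  have h0 : Algebra.TensorProduct.map (Ideal.Quotient.mkₐ k J) (AlgHom.id k H) (α.coact s) = 0 :=
    hq hs
  refine Ideal.Quotient.eq_zero_iff_mem.mp ?_
  change Ideal.Quotient.mkₐ k J _ = 0
  rw [← basis_repr_map, h0, map_zero, Finsupp.zero_apply]

variable [Module.Finite k H]

/-- The characteristic polynomial of `α(s)` acting on the free `S`-module `S ⊗ 𝒪(G)`: the product
of the `X - g s` over the points `g` of `G`, if `G` is constant. -/
noncomputable def charpoly (s : S) : Polynomial S :=
  (Algebra.lmul S (S ⊗[k] H) (α.coact s)).charpoly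

/-- The coefficients of the characteristic polynomial are invariant: coassociativity shows that the
two pullbacks of `α(s)` to `(S ⊗ 𝒪(G)) ⊗ 𝒪(G)` are conjugate under an automorphism. -/
theorem coeff_charpoly_mem (s : S) (i : ℕ) : (α.charpoly s).coeff i ∈ α.invariants := by
  let W := S ⊗[k] H
  let g : H →ₐ[k] W := Algebra.TensorProduct.includeRight
  let Θ : (W ⊗[k] H) ≃ₐ[W] (W ⊗[k] H) :=
    AlgEquiv.ofBijective (translation g) (translation_bijective g)
  have key : (α.charpoly s).map (α.coact : S →+* W) =
      (α.charpoly s).map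
        ((Algebra.TensorProduct.includeLeft : S →ₐ[k] W) : S →+* W) := by
    rw [charpoly, ← charpoly_lmul_map, ← charpoly_lmul_map, α.map_coact_coact,
      ← LinearEquiv.charpoly_conj Θ.toLinearEquiv (Algebra.lmul W (W ⊗[k] H)
        (Algebra.TensorProduct.map Algebra.TensorProduct.includeLeft (AlgHom.id k H) (α.coact s)))]
    congr 1
    refine LinearMap.ext fun z => ?_
    change translation g _ * z = Θ (_ * Θ.symm z)
    rw [map_mul, AlgEquiv.apply_symm_apply]
    rfl
  rw [mem_invariants]
  have := congrArg (fun q => q.coeff i) key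
  rwa [Polynomial.coeff_map, Polynomial.coeff_map] at this

theorem monic_charpoly (s : S) : (α.charpoly s).Monic := LinearMap.charpoly_monic _

theorem natDegree_charpoly [Nontrivial S] (s : S) :
    (α.charpoly s).natDegree = Module.finrank k H := by
  rw [charpoly, LinearMap.charpoly_natDegree, Module.finrank_baseChange]

/-- The Cayley–Hamilton theorem for the coaction. -/
theorem eval_charpoly (s : S) : (α.charpoly s).eval s = 0 := by
  apply α.coact_injective
  have h := Algebra.aeval_self_charpoly_lmul (R := S) (α.coact s)
  rw [Polynomial.aeval_eq_sum_range] at h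
  rw [map_zero, Polynomial.eval_eq_sum_range, map_sum, ← h]
  refine Finset.sum_congr rfl fun i _ => ?_
  rw [map_mul, map_pow, α.mem_invariants.mp (α.coeff_charpoly_mem s i), Algebra.smul_def]
  rfl

/-- If all coordinates of `α(s)` over `k` lie in the ideal `J`, then so do the lower coefficients
of the characteristic polynomial. -/
theorem coeff_charpoly_mem_of_repr_mem [Nontrivial S] {ι : Type*} (b : Module.Basis ι k H)
    {J : Ideal S} {s : S}
    (hs : ∀ i, (Algebra.TensorProduct.basis S b).repr (α.coact s) i ∈ J) {i : ℕ}
    (hi : i < Module.finrank k H) : (α.charpoly s).coeff i ∈ J := by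
  have h0 : Algebra.TensorProduct.map (Ideal.Quotient.mkₐ k J) (AlgHom.id k H) (α.coact s) = 0 := by
    apply (Algebra.TensorProduct.basis (S ⧸ J) b).repr.injective
    ext j
    rw [basis_repr_map, map_zero, Finsupp.zero_apply]
    exact Ideal.Quotient.eq_zero_iff_mem.mpr (hs j)
  by_cases hJ : J = ⊤
  · rw [hJ]; trivial
  have : Nontrivial (S ⧸ J) := Ideal.Quotient.nontrivial_iff.mpr hJ
  have h1 := charpoly_lmul_map (Ideal.Quotient.mkₐ k J) (α.coact s)
  rw [h0, map_zero, LinearMap.charpoly_zero, Module.finrank_baseChange] at h1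
  have h2 := congrArg (fun q => q.coeff i) h1
  rw [Polynomial.coeff_map, Polynomial.coeff_X_pow, if_neg hi.ne] at h2
  exact Ideal.Quotient.eq_zero_iff_mem.mp h2.symm

/-- A form of going down for `S` over its ring of invariants `R`: if `y s ∈ I S`, then a power of
`s` lies in the extension of `I : y` to `S`. The ideal `I` is assumed to be contracted from `S`. -/
theorem exists_pow_mem_map_colon {I : Ideal α.invariants}
    (hI : ∀ r, algebraMap α.invariants S r ∈ I.map (algebraMap α.invariants S) → r ∈ I)
    {y : α.invariants} {s : S}
    (hs : algebraMap α.invariants S y * s ∈ I.map (algebraMap α.invariants S)) :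
    ∃ n : ℕ, s ^ n ∈ Ideal.span (algebraMap α.invariants S '' {r | y * r ∈ I}) := by
  rcases subsingleton_or_nontrivial S with h | h
  · exact ⟨0, by rw [Subsingleton.elim (s ^ 0) 0]; exact zero_mem _⟩
  let b := Module.Free.chooseBasis k H
  let J : Ideal S := (I.map (algebraMap α.invariants S)).colon {algebraMap α.invariants S y}
  have hJ : ∀ x, x ∈ J ↔ algebraMap α.invariants S y * x ∈ I.map (algebraMap α.invariants S) :=
    fun x => by rw [Submodule.mem_colon_singleton, smul_eq_mul, mul_comm]
  have hrepr : ∀ i, (Algebra.TensorProduct.basis S b).repr (α.coact s) i ∈ J := fun i => by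
    have h1 := α.repr_coact_mem b hs i
    have h2 : α.coact (algebraMap α.invariants S y) = algebraMap α.invariants S y ⊗ₜ 1 := y.2
    have h3 : (algebraMap α.invariants S y ⊗ₜ[k] (1 : H)) * α.coact s =
        algebraMap α.invariants S y • α.coact s := by rw [Algebra.smul_def]; rfl
    rw [map_mul, h2, h3, map_smul, Finsupp.smul_apply, smul_eq_mul] at h1
    exact (hJ _).mpr h1
  refine ⟨Module.finrank k H, ?_⟩
  have h4 := α.eval_charpoly s
  rw [Polynomial.eval_eq_sum_range, α.natDegree_charpoly, Finset.sum_range_succ,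
    ← α.natDegree_charpoly s, (α.monic_charpoly s).coeff_natDegree, one_mul,
    α.natDegree_charpoly, add_comm] at h4
  rw [eq_neg_of_add_eq_zero_left h4]
  refine neg_mem (Submodule.sum_mem _ fun i hi => Ideal.mul_mem_right _ _ (Ideal.subset_span ?_))
  refine ⟨⟨_, α.coeff_charpoly_mem s i⟩, hI _ ?_, rfl⟩
  rw [map_mul]
  exact (hJ _).mp (α.coeff_charpoly_mem_of_repr_mem b hrepr (Finset.mem_range.mp hi))

end GroupSchemeAction

/-! ### Depth and height -/

section Depth

theorem DepthGE.exists_isSMulRegular {A : Type u} [CommRing A] [IsLocalRing A] (h : DepthGE A 1) :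
    ∃ a ∈ maximalIdeal A, IsSMulRegular A a := by
  obtain ⟨rs, hrs, hlen, hreg⟩ := h
  obtain ⟨a, rfl⟩ := List.length_eq_one_iff.mp hlen
  exact ⟨a, hrs a (by simp), ((RingTheory.Sequence.isRegular_cons_iff A a []).mp hreg).1⟩

theorem DepthGE.exists_regular_pair {A : Type u} [CommRing A] [IsLocalRing A] (h : DepthGE A 2) :
    ∃ a ∈ maximalIdeal A, ∃ b ∈ maximalIdeal A, IsSMulRegular A a ∧
      ∀ c : A, a ∣ b * c → a ∣ c := by
  obtain ⟨rs, hrs, hlen, hreg⟩ := h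
  obtain ⟨a, b, rfl⟩ := List.length_eq_two.mp hlen
  obtain ⟨ha, hreg'⟩ := (RingTheory.Sequence.isRegular_cons_iff A a [b]).mp hreg
  have hb := ((RingTheory.Sequence.isRegular_cons_iff _ b []).mp hreg').1
  have hmk : ∀ c : A, (Submodule.Quotient.mk c : QuotSMulTop a A) = 0 ↔ a ∣ c := fun c => by
    rw [Submodule.Quotient.mk_eq_zero, Submodule.mem_smul_pointwise_iff_exists]
    exact ⟨fun ⟨d, _, hd⟩ => ⟨d, hd.symm⟩, fun ⟨d, hd⟩ => ⟨d, trivial, hd.symm⟩⟩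
  refine ⟨a, hrs a (by simp), b, hrs b (by simp), ha, fun c hc => (hmk c).mp (hb ?_)⟩
  change b • (Submodule.Quotient.mk c : QuotSMulTop a A) = b • (0 : QuotSMulTop a A)
  rw [smul_zero, ← Submodule.Quotient.mk_smul, hmk]
  exact hc

theorem not_depthGE_one {A : Type u} [CommRing A] [IsLocalRing A] {w : A} (hw : w ≠ 0)
    (h : ∀ a ∈ maximalIdeal A, a * w = 0) : ¬ DepthGE A 1 := fun hd => by
  obtain ⟨a, ha, hreg⟩ := hd.exists_isSMulRegular
  exact hw (hreg (by simpa using h a ha))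

/-- The socle elements modulo one regular element give socle elements modulo any other one, so
they bound the depth by one. -/
theorem not_depthGE_two {A : Type u} [CommRing A] [IsLocalRing A] {x w : A}
    (hx : IsSMulRegular A x) (hw : ¬ x ∣ w) (h : ∀ a ∈ maximalIdeal A, x ∣ a * w) :
    ¬ DepthGE A 2 := fun hd => by
  obtain ⟨a, ha, b, hb, hreg, hab⟩ := hd.exists_regular_pair
  obtain ⟨w', hw'⟩ := h a ha
  have h1 : ∀ r ∈ maximalIdeal A, a ∣ r * w' := fun r hr => by
    obtain ⟨u, hu⟩ := h r hr
    refine ⟨u, hx ?_⟩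
    change x * (r * w') = x * (a * u)
    linear_combination -r * hw' + a * hu
  obtain ⟨v, hv⟩ := hab w' (h1 b hb)
  refine hw ⟨v, hreg ?_⟩
  change a * w = a * (x * v)
  rw [hw', hv]
  ring

variable {S : Type u} [CommRing S]

theorem IsSerreS2.height_eq_zero (hS : IsSerreS2 S) (Q : Ideal S) [Q.IsPrime] {w : S}
    (hw : ∀ s, s * w = 0 ↔ s ∈ Q) : Q.height = 0 := by
  by_contra hne
  have hd := hS Q 1 one_le_two (by simpa using Order.one_le_iff_ne_zero.mpr hne)
  refine not_depthGE_one (w := algebraMap S (Localization.AtPrime Q) w) ?_ ?_ hd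
  · intro h0
    obtain ⟨u, hu⟩ := (IsLocalization.map_eq_zero_iff Q.primeCompl _ w).mp h0
    exact u.2 ((hw u).mp hu)
  · intro a ha
    obtain ⟨q, u, rfl⟩ := IsLocalization.exists_mk'_eq Q.primeCompl a
    have hq : q ∈ Q :=
      (IsLocalization.AtPrime.mk'_mem_maximal_iff (Localization.AtPrime Q) Q q u).mp ha
    rw [IsLocalization.mk'_eq_mul_mk'_one, mul_right_comm, ← map_mul, (hw q).mpr hq, map_zero,
      zero_mul]

theorem IsSerreS2.height_le_one (hS : IsSerreS2 S) (Q : Ideal S) [Q.IsPrime] {x w : S}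
    (hx : IsSMulRegular S x) (hw : ∀ s, x ∣ s * w ↔ s ∈ Q) : Q.height ≤ 1 := by
  by_contra! hlt
  have hd := hS Q 2 le_rfl (by simpa [one_add_one_eq_two] using Order.add_one_le_of_lt hlt)
  refine not_depthGE_two (x := algebraMap S (Localization.AtPrime Q) x)
    (w := algebraMap S (Localization.AtPrime Q) w) ?_ ?_ ?_ hd
  · exact hx.of_isLocalization (Localization.AtPrime Q) Q.primeCompl
  · rintro ⟨a, ha⟩
    obtain ⟨q, u, rfl⟩ := IsLocalization.exists_mk'_eq Q.primeCompl a
    have h1 : algebraMap S (Localization.AtPrime Q) (u * w) =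
        algebraMap S (Localization.AtPrime Q) (x * q) := by
      rw [map_mul, map_mul, ha, ← IsLocalization.mk'_spec (Localization.AtPrime Q) q u]
      ring
    obtain ⟨v, hv⟩ := (IsLocalization.eq_iff_exists Q.primeCompl _).mp h1
    have h2 : (v * u : S) ∈ Q := (hw _).mp ⟨v * q, by rw [mul_assoc, hv]; ring⟩
    exact (v * u).2 h2
  · intro a ha
    obtain ⟨q, u, rfl⟩ := IsLocalization.exists_mk'_eq Q.primeCompl a
    have hq : q ∈ Q :=
      (IsLocalization.AtPrime.mk'_mem_maximal_iff (Localization.AtPrime Q) Q q u).mp ha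
    obtain ⟨s, hs⟩ := (hw q).mpr hq
    rw [IsLocalization.mk'_eq_mul_mk'_one, mul_right_comm, ← map_mul, hs, map_mul, mul_assoc]
    exact dvd_mul_right _ _

theorem Ideal.exists_mul_pow_mem_of_mem_minimalPrimes {I Q : Ideal S} (hQ : Q ∈ I.minimalPrimes)
    {x : S} (hx : x ∈ Q) : ∃ s ∉ Q, ∃ m : ℕ, x ^ m * s ∈ I := by
  have := hQ.1.1
  by_contra! hcon
  obtain ⟨P, hP, hIP, hd⟩ := Ideal.exists_le_prime_disjoint I
    (Submonoid.powers x ⊔ Q.primeCompl) <| by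
    rw [Set.disjoint_left]
    intro z hz hz'
    obtain ⟨_, ⟨m, rfl⟩, s, hs, rfl⟩ := Submonoid.mem_sup.mp hz'
    exact hcon s hs m hz
  rw [Set.disjoint_left] at hd
  have hPQ : P ≤ Q := fun z hz => by
    by_contra hzQ
    exact hd hz (le_sup_right (a := Submonoid.powers x) hzQ)
  exact hd (hQ.2 ⟨hP, hIP⟩ hPQ hx)
    (le_sup_left (b := Q.primeCompl) (Submonoid.mem_powers x))

theorem mem_minimalPrimes_span_singleton_of_height_le_one {Q : Ideal S} [hQ : Q.IsPrime] {x : S}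
    (hx : IsSMulRegular S x) (hxQ : x ∈ Q) (h : Q.height ≤ 1) :
    Q ∈ (Ideal.span {x}).minimalPrimes := by
  refine ⟨⟨hQ, (Ideal.span_singleton_le_iff_mem _).mpr hxQ⟩, fun P hP hPQ => ?_⟩
  by_contra hne
  have hlt : P < Q := lt_of_le_not_ge hPQ hne
  have := hP.1
  have h0 : P.height = 0 := by
    have := (Ideal.height_add_one_le_of_lt_of_isPrime hlt).trans h
    by_contra h1
    have h2 := (add_le_add_left (Order.one_le_iff_ne_zero.mpr h1) 1).trans this
    exact absurd h2 (by decide)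
  rw [Ideal.height_eq_zero_iff] at h0
  have hann : Module.annihilator S S = ⊥ := Module.annihilator_eq_bot.mpr inferInstance
  exact hx.notMem_of_mem_minimalPrimes (hann ▸ h0) ((Ideal.span_singleton_le_iff_mem _).mp hP.2)

end Depth

/-! ### Linear forms that generate the dual -/

section TraceDual

theorem exists_prime_height_one_or_dim_zero (R : Type u) [CommRing R] [IsDomain R] [IsLocalRing R]
    [IsNoetherianRing R] : ∃ P : Ideal R, P.IsPrime ∧ (P.height = 1 ∨ ringKrullDim R = 0) := by
  by_cases hm : maximalIdeal R = ⊥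
  · refine ⟨⊥, Ideal.isPrime_bot, Or.inr ?_⟩
    rw [← IsLocalRing.maximalIdeal_height_eq_ringKrullDim, hm]
    simp
  · obtain ⟨x, hx, hx0⟩ := Submodule.exists_mem_ne_zero_of_ne_bot hm
    obtain ⟨P, hP, -⟩ := Ideal.exists_minimalPrimes_le
      ((Ideal.span_singleton_le_iff_mem (maximalIdeal R)).mpr hx)
    have := hP.1.1
    refine ⟨P, hP.1.1, Or.inl (le_antisymm
      (Ideal.height_le_one_of_isPrincipal_of_mem_minimalPrimes _ P hP) ?_)⟩
    rw [Order.one_le_iff_ne_zero, Ne, Ideal.height_eq_zero_iff_eq_bot]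
    rintro rfl
    exact hx0 ((Ideal.span_singleton_le_iff_mem _).mp hP.1.2)

/-- As `R_P` has depth at least two, `P` contains `x ≠ 0` and `y` such that `y` is regular on
`R_P / x`. -/
theorem IsSerreS2.exists_pair {R : Type u} [CommRing R] [IsDomain R] (hR : IsSerreS2 R)
    (P : Ideal R) [P.IsPrime] (hP : 2 ≤ P.height) :
    ∃ x ∈ P, ∃ y ∈ P, x ≠ 0 ∧ ∀ (m : ℕ) (r : R), x ∣ y ^ m * r → r ∈ P := by
  obtain ⟨a, ha, b, hb, hreg, hab⟩ := (hR P 2 le_rfl (by simpa using hP)).exists_regular_pair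
  obtain ⟨x, u, rfl⟩ := IsLocalization.exists_mk'_eq P.primeCompl a
  obtain ⟨y, v, rfl⟩ := IsLocalization.exists_mk'_eq P.primeCompl b
  refine ⟨x, (IsLocalization.AtPrime.mk'_mem_maximal_iff _ P x u).mp ha, y,
    (IsLocalization.AtPrime.mk'_mem_maximal_iff _ P y v).mp hb, ?_, ?_⟩
  · rintro rfl
    rw [IsLocalization.mk'_zero, IsSMulRegular.zero_iff_subsingleton] at hreg
    exact not_subsingleton _ hreg
  · intro m r hr
    have h1 : IsLocalization.mk' (Localization.AtPrime P) x u ∣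
        IsLocalization.mk' (Localization.AtPrime P) y v ^ m *
          algebraMap R (Localization.AtPrime P) r := by
      obtain ⟨c, hc⟩ := hr
      refine ⟨algebraMap _ _ (c * u) * IsLocalization.mk' (Localization.AtPrime P) 1 v ^ m, ?_⟩
      have h2 := congrArg (algebraMap R (Localization.AtPrime P)) hc
      rw [map_mul, map_mul, map_pow] at h2
      rw [IsLocalization.mk'_eq_mul_mk'_one y v, mul_pow, map_mul]
      have h3 := IsLocalization.mk'_spec (Localization.AtPrime P) x u
      linear_combination (IsLocalization.mk' (Localization.AtPrime P) 1 v) ^ m * h2 -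
        (IsLocalization.mk' (Localization.AtPrime P) 1 v) ^ m * algebraMap _ _ c * h3
    have h4 : IsLocalization.mk' (Localization.AtPrime P) x u ∣
        algebraMap R (Localization.AtPrime P) r := by
      clear hr
      induction m with
      | zero => simpa using h1
      | succ m ih => exact ih (hab _ (by rwa [← mul_assoc, ← pow_succ']))
    have h5 := Ideal.mem_of_dvd _ h4 ha
    exact (IsLocalization.AtPrime.to_map_mem_maximal_iff _ P r).mp h5

variable {R : Type u} {S : Type v} [CommRing R] [IsDomain R] [IsNoetherianRing R] [CommRing S]
  [Algebra R S] [Module.Finite R S]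

theorem IsSerreS2.eq_zero_of_smul_eq_zero (hS : IsSerreS2 S)
    (hgd : ∀ (y : R) (s : S), algebraMap R S y * s = 0 → y ≠ 0 → IsNilpotent s)
    {x : R} (hx : x ≠ 0) {s : S} (hxs : x • s = 0) : s = 0 := by
  have : IsNoetherianRing S := IsNoetherianRing.of_finite R S
  by_contra hs
  obtain ⟨Q, hQ, hle⟩ := exists_le_isAssociatedPrime_of_isNoetherianRing S s hs
  have := hQ.isPrime
  obtain ⟨-, w, hw⟩ := isAssociatedPrime_iff.mp hQ
  -- the associated primes of `S` are minimal
  have hQ0 : Q.height = 0 := hS.height_eq_zero Q (w := w) fun s => by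
    rw [hw, Submodule.mem_colon_singleton, Submodule.mem_bot, smul_eq_mul]
  rw [Ideal.height_eq_zero_iff] at hQ0
  have hxQ : algebraMap R S x ∈ Q := hle (by
    rw [Submodule.mem_colon_singleton, Submodule.mem_bot, algebraMap_smul, hxs])
  obtain ⟨s', hs', m, hm⟩ := Ideal.exists_mul_pow_mem_of_mem_minimalPrimes hQ0 hxQ
  rw [Ideal.mem_bot, ← map_pow] at hm
  obtain ⟨n, hn⟩ := hgd _ _ hm (pow_ne_zero m hx)
  exact hs' (this.mem_of_pow_mem n (hn ▸ zero_mem _))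

/-- If `S` satisfies going down in the form `hgd` and is `S₂`, and `R` is `S₂`, then a linear form
`T` on `S` generates the dual of `S` as soon as it does so in codimension one. -/
theorem freelyGeneratesDual_of_codim_one [IsLocalRing R] (hR : IsSerreS2 R) (hS : IsSerreS2 S)
    (htf : ∀ (x : R) (s : S), x ≠ 0 → x • s = 0 → s = 0)
    (hgd : ∀ (x y : R) (s : S), algebraMap R S x ∣ algebraMap R S y * s →
      ∃ n : ℕ, s ^ n ∈ Ideal.span (algebraMap R S '' {r | x ∣ y * r}))
    {T : S →ₗ[R] R} (hinj : ∀ s, (∀ b, T (s * b) = 0) → s = 0)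
    (hcod : ∀ (P : Ideal R) [P.IsPrime], P.height = 1 ∨ ringKrullDim R = 0 →
      ∃ δ ∉ P, ∀ f : S →ₗ[R] R, ∃ s, ∀ b, δ * f b = T (s * b)) :
    FreelyGeneratesDual T := by
  have : IsNoetherianRing S := IsNoetherianRing.of_finite R S
  let φ : S →ₗ[R] (S →ₗ[R] R) := (LinearMap.mul R S).compr₂ T
  have hφ : ∀ s b, φ s b = T (s * b) := fun _ _ => rfl
  have hφinj : Function.Injective φ := by
    rw [← LinearMap.ker_eq_bot, LinearMap.ker_eq_bot']
    exact fun s hs => hinj s fun b => LinearMap.congr_fun hs b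
  suffices h : LinearMap.range φ = ⊤ from ⟨hφinj, LinearMap.range_eq_top.mp h⟩
  by_contra hne
  have : Nontrivial ((S →ₗ[R] R) ⧸ LinearMap.range φ) := Submodule.Quotient.nontrivial_iff.mpr hne
  obtain ⟨m0, hm0⟩ := exists_ne (0 : (S →ₗ[R] R) ⧸ LinearMap.range φ)
  obtain ⟨P, hP, -⟩ := exists_le_isAssociatedPrime_of_isNoetherianRing R m0 hm0
  have := hP.isPrime
  obtain ⟨-, d', hd'⟩ := isAssociatedPrime_iff.mp hP
  obtain ⟨d, rfl⟩ := Submodule.Quotient.mk_surjective _ d'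
  have hd : ∀ r, r ∈ P ↔ r • d ∈ LinearMap.range φ := fun r => by
    rw [hd', Submodule.mem_colon_singleton, Submodule.mem_bot, ← Submodule.Quotient.mk_smul,
      Submodule.Quotient.mk_eq_zero]
  -- `P`, an associated prime of the cokernel of `φ`, has height at least two
  have hcod' : ∀ (P' : Ideal R) [P'.IsPrime], P'.height = 1 ∨ ringKrullDim R = 0 → ¬ P ≤ P' := by
    intro P' _ h hle
    obtain ⟨δ, hδ, hf⟩ := hcod P' h
    obtain ⟨s, hs⟩ := hf d
    exact hδ (hle ((hd δ).mpr ⟨s, LinearMap.ext fun b => (hs b).symm⟩))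
  have hP2 : 2 ≤ P.height := by
    by_contra! hlt
    rcases eq_or_ne P.height 0 with h0 | h0
    · rw [Ideal.height_eq_zero_iff_eq_bot] at h0
      obtain ⟨P', hP', h⟩ := exists_prime_height_one_or_dim_zero R
      exact hcod' P' h (h0 ▸ bot_le)
    · exact hcod' P (Or.inl (le_antisymm (Order.le_of_lt_add_one (by
        simpa [one_add_one_eq_two] using hlt)) (Order.one_le_iff_ne_zero.mpr h0))) le_rfl
  obtain ⟨x, hxP, y, hyP, hx0, hxy⟩ := hR.exists_pair P hP2
  obtain ⟨s, hs⟩ := (hd x).mp hxP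
  -- `P` is the annihilator in `R` of the class of `s` modulo `x`
  have hann : ∀ r, algebraMap R S x ∣ algebraMap R S r * s ↔ r ∈ P := by
    intro r
    rw [hd]
    constructor
    · rintro ⟨s', hs'⟩
      refine ⟨s', LinearMap.ext fun b => mul_left_cancel₀ hx0 ?_⟩
      have h1 : φ (r • s) = φ (x • s') := by rw [Algebra.smul_def, hs', Algebra.smul_def]
      rw [map_smul, map_smul, hs] at h1
      have h2 := LinearMap.congr_fun h1 b
      simp only [LinearMap.smul_apply, smul_eq_mul] at h2 ⊢
      rw [← h2]; ring
    · rintro ⟨s', hs'⟩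
      refine ⟨s', ?_⟩
      rw [← Algebra.smul_def, ← Algebra.smul_def]
      apply hφinj
      rw [map_smul, map_smul, hs, hs', smul_comm]
  have hxreg : IsSMulRegular S (algebraMap R S x) :=
    fun a b hab => sub_eq_zero.mp (htf x _ hx0 (by
      rw [Algebra.smul_def, mul_sub, sub_eq_zero]
      exact hab))
  -- a prime `Q` over `P` that is minimal over the annihilator of the class of `s` in `S / x`
  let M := S ⧸ Ideal.span {algebraMap R S x}
  let N : Submodule S M := Submodule.span S {(Ideal.Quotient.mk _ s : M)}
  have hmk : ∀ z : S, (Ideal.Quotient.mk (Ideal.span {algebraMap R S x}) z) = 0 ↔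
      algebraMap R S x ∣ z := fun z => by
    rw [Ideal.Quotient.eq_zero_iff_mem, Ideal.mem_span_singleton]
  have hN : ∀ z, z ∈ Module.annihilator S N ↔ algebraMap R S x ∣ z * s := fun z => by
    rw [Submodule.mem_annihilator_span_singleton, ← hmk, map_mul]
    rfl
  obtain ⟨Q', hQ'le, hQ', hQ'P⟩ := Ideal.exists_ideal_over_prime_of_isIntegral P
    (Module.annihilator S N) fun r hr => (hann r).mp ((hN _).mp hr)
  obtain ⟨Q, hQ, hQQ'⟩ := Ideal.exists_minimalPrimes_le hQ'le
  have hQP : Q.comap (algebraMap R S) = P := le_antisymm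
    ((Ideal.comap_mono hQQ').trans hQ'P.le) fun r hr => hQ.1.2 ((hN _).mpr ((hann r).mpr hr))
  have hQass : IsAssociatedPrime Q M := associatedPrimes.subset_of_injective N.injective_subtype
    (Module.associatedPrimes.minimalPrimes_annihilator_subset_associatedPrimes S N hQ)
  have := hQass.isPrime
  obtain ⟨-, w', hw'⟩ := isAssociatedPrime_iff.mp hQass
  obtain ⟨w, rfl⟩ := Ideal.Quotient.mk_surjective w'
  have hQ1 : Q.height ≤ 1 := hS.height_le_one Q (w := w) hxreg fun z => by
    rw [← hmk, hw', Submodule.mem_colon_singleton, Submodule.mem_bot, map_mul]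
    rfl
  -- so `Q` is minimal over `x`, which contradicts going down, applied to a power of `y`
  have hxQ : algebraMap R S x ∈ Q := by rw [← Ideal.mem_comap, hQP]; exact hxP
  have hyQ : algebraMap R S y ∈ Q := by rw [← Ideal.mem_comap, hQP]; exact hyP
  obtain ⟨s', hs', m, hm⟩ := Ideal.exists_mul_pow_mem_of_mem_minimalPrimes
    (mem_minimalPrimes_span_singleton_of_height_le_one hxreg hxQ hQ1) hyQ
  rw [Ideal.mem_span_singleton, ← map_pow] at hm
  obtain ⟨n, hn⟩ := hgd _ _ _ hm
  refine hs' (this.mem_of_pow_mem n (Ideal.span_le.mpr ?_ hn))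
  rintro _ ⟨r, hr, rfl⟩
  change r ∈ Q.comap (algebraMap R S)
  rw [hQP]
  exact hxy m r hr


end TraceDual

section TraceForm

variable {R : Type u} {S : Type v} [CommRing R] [IsDomain R] [CommRing S] [Algebra R S]
  [Module.Finite R S]

/-- If `M` is free at `P`, then a basis at `P` can be chosen in `M`, and it spans `M` up to an
element outside `P`. -/
theorem exists_basis_of_flat_localization {M : Type*} [AddCommGroup M] [Module R M]
    [Module.Finite R M] (P : Ideal R) [P.IsPrime]
    [Module.Flat (Localization.AtPrime P) (LocalizedModule P.primeCompl M)] :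
    ∃ (n : ℕ) (e : Fin n → M), LinearIndependent R e ∧
      ∃ u ∉ P, ∀ m : M, u • m ∈ Submodule.span R (Set.range e) := by
  have : Module.Finite (Localization.AtPrime P) (LocalizedModule P.primeCompl M) :=
    Module.Finite.of_isLocalizedModule P.primeCompl (LocalizedModule.mkLinearMap P.primeCompl M)
  have : Module.Free (Localization.AtPrime P) (LocalizedModule P.primeCompl M) :=
    Module.free_of_flat_of_isLocalRing
  let b := Module.finBasis (Localization.AtPrime P) (LocalizedModule P.primeCompl M)
  let f := LocalizedModule.mkLinearMap P.primeCompl M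
  have hb : ∀ i, ∃ (e : M) (u : P.primeCompl), f e = u • b i := fun i => by
    obtain ⟨⟨e, u⟩, h⟩ := IsLocalizedModule.surj P.primeCompl f (b i)
    exact ⟨e, u, h.symm⟩
  choose e u he using hb
  have hsm : ∀ (r : R) (x : LocalizedModule P.primeCompl M),
      r • x = algebraMap R (Localization.AtPrime P) r • x := fun r x => (algebraMap_smul _ r x).symm
  refine ⟨_, e, ?_, ?_⟩
  · rw [Fintype.linearIndependent_iff]
    intro g hg i
    have h1 := congrArg f hg
    rw [map_sum, map_zero] at h1
    simp only [map_smul, he, Submonoid.smul_def, smul_smul] at h1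
    simp only [hsm] at h1
    have h2 := Fintype.linearIndependent_iff.mp b.linearIndependent _ h1 i
    rw [FaithfulSMul.algebraMap_eq_zero_iff] at h2
    exact (mul_eq_zero.mp h2).resolve_right fun h0 => (u i).2 (h0 ▸ zero_mem P)
  · have htop : Submodule.localized' (Localization.AtPrime P) P.primeCompl f
        (Submodule.span R (Set.range e)) = ⊤ := by
      rw [Submodule.localized'_span, eq_top_iff, ← b.span_eq, Submodule.span_le]
      rintro _ ⟨i, rfl⟩
      have hu : IsUnit (algebraMap R (Localization.AtPrime P) (u i)) :=
        IsLocalization.map_units _ (u i)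
      rw [SetLike.mem_coe, ← Submodule.smul_mem_iff_of_isUnit _ hu, ← hsm]
      exact Submodule.subset_span ⟨e i, ⟨i, rfl⟩, he i⟩
    have hex : ∀ m : M, ∃ v ∉ P, v • m ∈ Submodule.span R (Set.range e) := by
      intro m
      obtain ⟨m', hm', s, hs⟩ := (Submodule.mem_localized' _ _ _ _ _).mp
        (show f m ∈ Submodule.localized' (Localization.AtPrime P) P.primeCompl f
          (Submodule.span R (Set.range e)) by rw [htop]; trivial)
      rw [IsLocalizedModule.mk'_eq_iff, Submonoid.smul_def, ← map_smul,
        IsLocalizedModule.eq_iff_exists P.primeCompl] at hs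
      obtain ⟨c, hc⟩ := hs
      refine ⟨c * s, (c * s).2, ?_⟩
      rw [mul_smul]
      change c • ((s : R) • m) ∈ _
      rw [← hc]
      exact Submodule.smul_mem _ _ hm'
    obtain ⟨G, hG⟩ := Module.Finite.fg_top (R := R) (M := M)
    choose v hvP hv using hex
    classical
    refine ⟨∏ g ∈ G, v g, fun h => ?_, fun m => ?_⟩
    · obtain ⟨g, -, hg⟩ := (Ideal.IsPrime.prod_mem_iff).mp h
      exact hvP g hg
    · have hm : m ∈ Submodule.span R (G : Set M) := hG ▸ trivial
      induction hm using Submodule.span_induction with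
      | mem x hx =>
        rw [← Finset.prod_erase_mul _ _ hx, mul_smul]
        exact Submodule.smul_mem _ _ (hv x)
      | zero => rw [smul_zero]; exact zero_mem _
      | add x y _ _ hx hy => rw [smul_add]; exact add_mem hx hy
      | smul a x _ hx => rw [smul_comm]; exact Submodule.smul_mem _ _ hx

/-- A linear form on `S` whose trace form is nondegenerate at `P` generates the dual of `S` up to
an element outside `P`, and its trace form is nondegenerate. -/
theorem exists_dual_generator_of_nondegenerate (T : S →ₗ[R] R) (P : Ideal R) [P.IsPrime]
    [Module.Flat (Localization.AtPrime P) (LocalizedModule P.primeCompl S)]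
    (hT : ∀ s, (∀ b, T (s * b) ∈ P) → ∃ u ∉ P, u • s ∈ P • (⊤ : Submodule R S)) :
    (∃ δ ∉ P, ∀ f : S →ₗ[R] R, ∃ s, ∀ b, δ * f b = T (s * b)) ∧
      ((∀ (x : R) (s : S), x ≠ 0 → x • s = 0 → s = 0) →
        ∀ s, (∀ b, T (s * b) = 0) → s = 0) := by
  obtain ⟨n, e, hind, u, huP, hu⟩ := exists_basis_of_flat_localization (M := S) P
  have hu0 : u ≠ 0 := fun h => huP (h ▸ zero_mem _)
  let G : Matrix (Fin n) (Fin n) R := Matrix.of fun i j => T (e i * e j)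
  have hG : ∀ (v : Fin n → R) i, G.mulVec v i = T ((∑ j, v j • e j) * e i) := fun v i => by
    rw [Finset.sum_mul, map_sum, Matrix.mulVec, dotProduct]
    refine Finset.sum_congr rfl fun j _ => ?_
    rw [smul_mul_assoc, map_smul, smul_eq_mul, mul_comm (v j), mul_comm (e j)]
    rfl
  have hext : ∀ (f g : S →ₗ[R] R), (∀ i, f (e i) = g (e i)) → f = g := by
    intro f g hfg
    have hle : Submodule.span R (Set.range e) ≤ LinearMap.eqLocus f g :=
      Submodule.span_le.mpr (by rintro _ ⟨i, rfl⟩; exact hfg i)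
    refine LinearMap.ext fun b => mul_left_cancel₀ hu0 ?_
    rw [← smul_eq_mul, ← smul_eq_mul, ← map_smul, ← map_smul]
    exact hle (hu b)
  -- a vector in the kernel of the Gram matrix modulo `P` would contradict nondegeneracy
  have hdet : G.det ∉ P := by
    intro hdet
    have h1 : (G.map (Ideal.Quotient.mk P)).det = 0 := by
      rw [← RingHom.mapMatrix_apply, ← RingHom.map_det]
      exact Ideal.Quotient.eq_zero_iff_mem.mpr hdet
    obtain ⟨w, hw0, hw⟩ := Matrix.exists_mulVec_eq_zero_iff.mpr h1
    choose v hv using fun i => Ideal.Quotient.mk_surjective (w i)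
    have h2 : ∀ i, T ((∑ j, v j • e j) * e i) ∈ P := fun i => by
      rw [← hG, ← Ideal.Quotient.eq_zero_iff_mem, RingHom.map_mulVec]
      have : (Ideal.Quotient.mk P) ∘ v = w := funext hv
      rw [this, hw, Pi.zero_apply]
    have h3 : ∀ b, T ((∑ j, v j • e j) * b) ∈ P := fun b => by
      refine (Ideal.IsPrime.mem_or_mem (I := P) inferInstance (x := u) ?_).resolve_left huP
      rw [← smul_eq_mul, ← map_smul, ← mul_smul_comm]
      have h4 : Submodule.span R (Set.range e) ≤
          Submodule.comap (T ∘ₗ LinearMap.mulLeft R (∑ j, v j • e j)) P := by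
        rw [Submodule.span_le]
        rintro _ ⟨i, rfl⟩
        exact h2 i
      exact h4 (hu b)
    obtain ⟨u', hu'P, hu'⟩ := hT _ h3
    have h5 : u • (u' • ∑ j, v j • e j) ∈ P • Submodule.span R (Set.range e) := by
      refine Submodule.smul_induction_on hu' (fun r hr m _ => ?_) fun x y hx hy => ?_
      · rw [smul_comm]
        exact Submodule.smul_mem_smul hr (hu m)
      · rw [smul_add]
        exact add_mem hx hy
    obtain ⟨a, ha, hsum⟩ := (Submodule.mem_ideal_smul_span_iff_exists_sum _ _ _).mp h5
    rw [Finsupp.sum_fintype _ _ (by simp), Finset.smul_sum, Finset.smul_sum] at hsum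
    have h6 := Fintype.linearIndependent_iff.mp hind (fun j => a j - u * (u' * v j)) (by
      rw [← sub_eq_zero, ← Finset.sum_sub_distrib] at hsum
      rw [← hsum]
      exact Finset.sum_congr rfl fun j _ => by rw [sub_smul, mul_smul, mul_smul])
    refine hw0 (funext fun j => ?_)
    rw [← hv, Pi.zero_apply, Ideal.Quotient.eq_zero_iff_mem]
    have h7 : u * (u' * v j) ∈ P := by rw [← sub_eq_zero.mp (h6 j)]; exact ha j
    exact ((Ideal.IsPrime.mem_or_mem inferInstance
      ((Ideal.IsPrime.mem_or_mem inferInstance h7).resolve_left huP)).resolve_left hu'P)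
  refine ⟨⟨G.det, hdet, fun f => ?_⟩, fun htf s hs => ?_⟩
  · -- Cramer's rule
    refine ⟨∑ j, G.adjugate.mulVec (fun i => f (e i)) j • e j, fun b => ?_⟩
    have := hext (G.det • f)
      (T ∘ₗ LinearMap.mulLeft R (∑ j, G.adjugate.mulVec (fun i => f (e i)) j • e j)) fun i => by
        rw [LinearMap.comp_apply, LinearMap.mulLeft_apply, ← hG, Matrix.mulVec_mulVec,
          Matrix.mul_adjugate, Matrix.smul_mulVec, Matrix.one_mulVec]
        rfl
    exact LinearMap.congr_fun this b
  · obtain ⟨v, hv⟩ := (Submodule.mem_span_range_iff_exists_fun R).mp (hu s)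
    refine htf u s hu0 ?_
    have h1 : G.mulVec v = 0 := funext fun i => by
      rw [hG, hv, smul_mul_assoc, map_smul, hs, smul_zero, Pi.zero_apply]
    have h2 : G.det • v = 0 := by
      rw [← Matrix.one_mulVec v, ← Matrix.smul_mulVec, ← Matrix.adjugate_mul,
        ← Matrix.mulVec_mulVec, h1, Matrix.mulVec_zero]
    have hdet0 : G.det ≠ 0 := fun h => hdet (h ▸ zero_mem _)
    rw [← hv, (smul_eq_zero_iff_right hdet0).mp h2]
    simp

end TraceForm

/-! ### Generic ranks -/

section Rank

theorem finrank_fractionRing_tensorProduct (R : Type u) (M : Type v) [CommRing R] [IsDomain R]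
    [AddCommGroup M] [Module R M] :
    Module.finrank (FractionRing R) (FractionRing R ⊗[R] M) = Module.finrank R M := by
  have := isLocalizedModule_iff_isBaseChange (nonZeroDivisors R) (FractionRing R)
    (TensorProduct.mk R (FractionRing R) M 1)
  have := this.mpr (TensorProduct.isBaseChange R M (FractionRing R))
  rw [← IsLocalizedModule.finrank_eq (nonZeroDivisors R) (TensorProduct.mk R (FractionRing R) M 1)
    le_rfl, IsLocalization.finrank_eq (FractionRing R) (nonZeroDivisors R) le_rfl]

theorem finrank_tensorProduct_of_isDomain (R : Type u) (M : Type v) (N : Type w) [CommRing R]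
    [IsDomain R] [AddCommGroup M] [Module R M] [AddCommGroup N] [Module R N] :
    Module.finrank R (M ⊗[R] N) = Module.finrank R M * Module.finrank R N := by
  rw [← finrank_fractionRing_tensorProduct R, ← finrank_fractionRing_tensorProduct R M,
    ← finrank_fractionRing_tensorProduct R N, ← Module.finrank_tensorProduct (R := FractionRing R),
    (TensorProduct.AlgebraTensorModule.distribBaseChange R (FractionRing R) M N).finrank_eq]

theorem finrank_pi_of_isDomain (R : Type u) (M : Type v) [CommRing R] [IsDomain R]
    [AddCommGroup M] [Module R M] [Module.Finite R M] (ι : Type*) [Fintype ι] :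
    Module.finrank R (ι → M) = Fintype.card ι * Module.finrank R M := by
  classical
  rw [← finrank_fractionRing_tensorProduct R, ← finrank_fractionRing_tensorProduct R M,
    (TensorProduct.piRight R (FractionRing R) (FractionRing R) fun _ : ι => M).finrank_eq,
    Module.finrank_pi_fintype, Finset.sum_const, Finset.card_univ, smul_eq_mul]

theorem finrank_eq_of_bijective_localizedModule_map {R : Type u} [CommRing R] [IsDomain R]
    {M : Type v} {N : Type w} [AddCommGroup M] [Module R M] [AddCommGroup N] [Module R N]
    (f : M →ₗ[R] N) (P : Ideal R) [P.IsPrime]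
    (hf : Function.Bijective (LocalizedModule.map P.primeCompl f)) :
    Module.finrank R M = Module.finrank R N := by
  rw [← IsLocalizedModule.finrank_eq P.primeCompl (LocalizedModule.mkLinearMap P.primeCompl M)
      P.primeCompl_le_nonZeroDivisors,
    ← IsLocalizedModule.finrank_eq P.primeCompl (LocalizedModule.mkLinearMap P.primeCompl N)
      P.primeCompl_le_nonZeroDivisors]
  exact ((LinearEquiv.ofBijective _ hf).restrictScalars R).finrank_eq

end Rank

/-! ### Quotients by finite group-schemes -/

namespace GroupSchemeAction

variable {k : Type u} {S : Type v} {H : Type w} [Field k] [CommRing S] [Algebra k S] [CommRing H]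
  [HopfAlgebra k H] (α : GroupSchemeAction k S H)

theorem coe_trace (t : H →ₗ[k] k) (ht : IsLeftIntegral t) (s : S) :
    (α.trace t ht s : S) = TensorProduct.rid k S (t.lTensor S (α.coact s)) := rfl

theorem canonicalMap_tmul (a b : S) : α.canonicalMap (a ⊗ₜ b) = a ⊗ₜ 1 * α.coact b := by
  simp only [canonicalMap]
  rfl

/-- Since a multiple of the trace splits `R ⊆ S`, ideals of `R` are contracted from `S`. -/
theorem mem_of_algebraMap_mem_map {t : H →ₗ[k] k} {ht : IsLeftIntegral t}
    (hs : Function.Surjective (α.trace t ht)) (I : Ideal α.invariants) (r : α.invariants)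
    (hr : algebraMap α.invariants S r ∈ I.map (algebraMap α.invariants S)) : r ∈ I := by
  obtain ⟨s0, hs0⟩ := hs 1
  have h1 : ∀ z ∈ I.map (algebraMap α.invariants S), ∀ s, α.trace t ht (z * s) ∈ I := by
    intro z hz
    induction hz using Submodule.span_induction with
    | mem x hx =>
      obtain ⟨r, hr, rfl⟩ := hx
      intro s
      rw [← Algebra.smul_def, map_smul, smul_eq_mul]
      exact Ideal.mul_mem_right _ _ hr
    | zero => intro s; rw [zero_mul, map_zero]; exact zero_mem _
    | add x y _ _ hx hy => intro s; rw [add_mul, map_add]; exact add_mem (hx s) (hy s)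
    | smul a x _ hx => intro s; rw [smul_eq_mul, mul_comm a, mul_assoc]; exact hx _
  have h2 := h1 _ hr s0
  rwa [← Algebra.smul_def, map_smul, hs0, smul_eq_mul, mul_one] at h2

/-- At a prime where `S` is a torsor the trace form is nondegenerate: the element `1 ⊗ x`, for which
`t (h x)` is the counit of `h`, is locally in the image of the canonical map. -/
theorem exists_smul_mem_of_trace_mem [Module.Finite k H] {t : H →ₗ[k] k} (ht : IsLeftIntegral t)
    (ht0 : t ≠ 0) (P : Ideal α.invariants) [P.IsPrime]
    (hP : Function.Surjective (LocalizedModule.map P.primeCompl α.canonicalMap.toLinearMap))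
    (s : S) (hs : ∀ b, α.trace t ht (s * b) ∈ P) :
    ∃ u ∉ P, u • s ∈ P • (⊤ : Submodule α.invariants S) := by
  obtain ⟨x, hx⟩ := ht.exists_counit_eq ht0
  obtain ⟨z', hz'⟩ := hP (LocalizedModule.mk (1 ⊗ₜ x) 1)
  induction z' using LocalizedModule.induction_on with | h z v
  rw [LocalizedModule.map_mk, LocalizedModule.mk_eq] at hz'
  obtain ⟨c, hc⟩ := hz'
  rw [one_smul] at hc
  -- `L` sends `1 ⊗ x` to `s`, and the image of the canonical map into `P S`
  let L : S ⊗[k] H →ₗ[α.invariants] S :=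
    { toFun := fun y => TensorProduct.rid k S (t.lTensor S (α.coact s * y))
      map_add' := fun a b => by rw [mul_add, map_add, map_add]
      map_smul' := fun r y => by
        rw [mul_smul_comm, RingHom.id_apply]
        generalize α.coact s * y = w
        induction w with
        | zero => simp
        | add a b ha hb => rw [smul_add, map_add, map_add, ha, hb, map_add, map_add, smul_add]
        | tmul a h =>
          change TensorProduct.rid k S (t.lTensor S ((r • a) ⊗ₜ h)) = _
          rw [LinearMap.lTensor_tmul, LinearMap.lTensor_tmul, TensorProduct.rid_tmul,
            TensorProduct.rid_tmul]
          exact (mul_smul_comm (t h) (r : S) a).symm }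
  have h1 : L (1 ⊗ₜ x) = s := by
    change TensorProduct.rid k S (t.lTensor S (α.coact s * 1 ⊗ₜ x)) = s
    conv_rhs => rw [← α.counit s]
    generalize α.coact s = w
    induction w with
    | zero => simp
    | add a b ha hb => rw [add_mul, map_add, map_add, ha, hb, map_add, map_add]
    | tmul a h => simp [hx]
  have h2 : ∀ z : S ⊗[α.invariants] S,
      L (α.canonicalMap z) ∈ P • (⊤ : Submodule α.invariants S) := by
    intro z
    induction z with
    | zero => rw [map_zero, map_zero]; exact zero_mem _
    | add a b ha hb => rw [map_add, map_add]; exact add_mem ha hb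
    | tmul a b =>
      have h3 : L (α.canonicalMap (a ⊗ₜ b)) = α.trace t ht (s * b) • a := by
        rw [canonicalMap_tmul]
        change TensorProduct.rid k S (t.lTensor S (α.coact s * (a ⊗ₜ 1 * α.coact b))) =
          (α.trace t ht (s * b) : S) * a
        rw [mul_left_comm, ← map_mul, coe_trace]
        generalize α.coact (s * b) = w
        induction w with
        | zero => simp
        | add x y hx hy => rw [mul_add, map_add, map_add, hx, hy, map_add, map_add, add_mul]
        | tmul x h => simp [mul_comm]
      rw [h3]
      exact Submodule.smul_mem_smul (hs b) trivial
  refine ⟨c * v, (c * v).2, ?_⟩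
  have h4 : L (c • α.canonicalMap z) = L (c • v • 1 ⊗ₜ x) := congrArg L hc
  simp only [Submonoid.smul_def, map_smul, h1] at h4
  rw [mul_smul, ← h4]
  exact Submodule.smul_mem _ _ (h2 z)

variable [Module.Finite k H] [IsLocalRing α.invariants] [IsNoetherianRing α.invariants]
  [IsDomain α.invariants] [Module.Finite α.invariants S]

/-- The trace generates the dual of `S` over `R = S^G`. -/
theorem freelyGeneratesDual_trace (hS : IsSerreS2 S) (hR : IsSerreS2 α.invariants)
    (hα : α.IsTorsorInCodimOne) {t : H →ₗ[k] k} (ht : IsLeftIntegral t) (ht0 : t ≠ 0)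
    (hs : Function.Surjective (α.trace t ht)) : FreelyGeneratesDual (α.trace t ht) := by
  have hgd : ∀ (x y : α.invariants) (s : S),
      algebraMap α.invariants S x ∣ algebraMap α.invariants S y * s →
      ∃ n : ℕ, s ^ n ∈ Ideal.span (algebraMap α.invariants S '' {r | x ∣ y * r}) := by
    intro x y s h
    obtain ⟨n, hn⟩ := α.exists_pow_mem_map_colon (I := Ideal.span {x})
      (α.mem_of_algebraMap_mem_map hs _) (y := y) (s := s) (by
        rwa [Ideal.map_span, Set.image_singleton, Ideal.mem_span_singleton])
    simp only [Ideal.mem_span_singleton] at hn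
    exact ⟨n, hn⟩
  have htf : ∀ (x : α.invariants) (s : S), x ≠ 0 → x • s = 0 → s = 0 := by
    intro x s hx hxs
    refine hS.eq_zero_of_smul_eq_zero (fun y s h hy => ?_) hx hxs
    obtain ⟨n, hn⟩ := hgd 0 y s (by rw [h, map_zero])
    refine ⟨n, ?_⟩
    have hle : Ideal.span (algebraMap α.invariants S '' {r | 0 ∣ y * r}) ≤ ⊥ := by
      rw [Ideal.span_le]
      rintro _ ⟨r, hr, rfl⟩
      have : r = 0 := (mul_eq_zero.mp (zero_dvd_iff.mp hr)).resolve_left hy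
      rw [this, map_zero]
      exact zero_mem _
    exact hle hn
  have hgen : ∀ (P : Ideal α.invariants) [P.IsPrime],
      P.height = 1 ∨ ringKrullDim α.invariants = 0 → _ := fun P _ h => by
    have hflat := (hα P h).1
    exact exists_dual_generator_of_nondegenerate (α.trace t ht) P
      (α.exists_smul_mem_of_trace_mem ht ht0 P (hα P h).2.2)
  obtain ⟨P, hP, h⟩ := exists_prime_height_one_or_dim_zero α.invariants
  exact freelyGeneratesDual_of_codim_one hR hS htf hgd ((hgen P h).2 htf)
    fun P _ h => (hgen P h).1

/-- A torsor in codimension one has rank the order of the group: compare the ranks of `S ⊗ S` and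
`S ⊗ 𝒪(G)`. -/
theorem finrank_eq_of_isTorsorInCodimOne (hα : α.IsTorsorInCodimOne) :
    Module.finrank α.invariants S = Module.finrank k H := by
  obtain ⟨P, hP, h⟩ := exists_prime_height_one_or_dim_zero α.invariants
  have h1 := finrank_eq_of_bijective_localizedModule_map α.canonicalMap.toLinearMap P (hα P h).2
  have h2 := finrank_tensorProduct_of_isDomain α.invariants S S
  have h3 : Module.finrank α.invariants (S ⊗[k] H) =
      Module.finrank k H * Module.finrank α.invariants S := by
    let b := Algebra.TensorProduct.basis S (Module.finBasis k H)
    rw [(b.equivFun.restrictScalars α.invariants).finrank_eq, finrank_pi_of_isDomain,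
      Fintype.card_fin]
  have h4 := LinearMap.finrank_le_finrank_of_injective
    (f := Algebra.linearMap α.invariants S) Subtype.val_injective
  rw [Module.finrank_self] at h4
  exact Nat.eq_of_mul_eq_mul_right h4 (h2.symm.trans (h1.trans h3))

end GroupSchemeAction

theorem theoremB (p : ℕ) [Fact p.Prime] :
    -- the transformation rule for finite local extensions
    (∀ {A : Type*} {B : Type*} [CommRing A] [CommRing B] [IsLocalRing A] [IsLocalRing B]
        [IsNoetherianRing A] [CharP A p] [CharP B p] [Algebra A B] [IsLocalHom (algebraMap A B)],
      IsFFinite p A → Function.Injective (algebraMap A B) → Module.Finite A B →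
      Module.IsReflexive A B →
      ∀ T : B →ₗ[A] A, FreelyGeneratesDual T → Function.Surjective T →
      (∀ b ∈ maximalIdeal B, T b ∈ maximalIdeal A) →
        FSignatureExists p A ∧ FSignatureExists p B ∧
        (¬ IsDomain A → fSignature p A = 0 ∧ fSignature p B = 0) ∧
        (IsDomain A →
          (Module.finrank (ResidueField A) (ResidueField B) : ℝ) * fSignature p B =
            (Module.finrank (FractionRing A) (FractionRing A ⊗[A] B) : ℝ) * fSignature p A) ∧
        (IsStronglyFRegular p B ↔ IsStronglyFRegular p A) ∧
        (IsStronglyFRegular p B ∧ IsDomain B ↔ IsStronglyFRegular p A ∧ IsDomain A)) ∧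
    -- the case of a quotient by a finite group-scheme `G = Spec H` over a field `k`
    (∀ {k : Type*} {S : Type*} {H : Type*} [Field k] [CommRing S] [Algebra k S] [CommRing H]
        [HopfAlgebra k H] [IsLocalRing S] [CharP S p] (α : GroupSchemeAction k S H)
        [IsLocalRing α.invariants] [IsNoetherianRing α.invariants]
        [IsLocalHom (algebraMap α.invariants S)],
      Module.Finite k H → IsFFinite p S → IsSerreS2 S → IsSerreS2 α.invariants →
      Module.Finite α.invariants S → α.IsTorsorInCodimOne →
      ∀ (t : H →ₗ[k] k) (ht : IsLeftIntegral t), t ≠ 0 →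
      Function.Surjective (α.trace t ht) →
      (∀ s ∈ maximalIdeal S, α.trace t ht s ∈ maximalIdeal α.invariants) →
        FSignatureExists p α.invariants ∧ FSignatureExists p S ∧
        (Module.finrank (ResidueField α.invariants) (ResidueField S) : ℝ) * fSignature p S =
          (Module.finrank k H : ℝ) * fSignature p α.invariants) := by
  constructor
  · intro A B _ _ _ _ _ _ _ _ _ hF hinj hfin _ T hT hs hm
    have hsfr : IsStronglyFRegular p B ↔ IsStronglyFRegular p A :=
      ⟨fun h => h.to_base hinj hs, fun h => h.of_base hT hs hm⟩
    have : IsNoetherianRing B := IsNoetherianRing.of_finite A B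
    have hsfr' : IsStronglyFRegular p B ∧ IsDomain B ↔ IsStronglyFRegular p A ∧ IsDomain A :=
      ⟨fun h => ⟨hsfr.mp h.1, (hsfr.mp h.1).isDomain⟩,
        fun h => ⟨hsfr.mpr h.1, (hsfr.mpr h.1).isDomain⟩⟩
    by_cases hA : IsDomain A
    · obtain ⟨hB, heq⟩ := fSignature_transformation_of_isDomain hF hinj hT hs hm
      exact ⟨fSignatureExists_of_isDomain hF, hB, fun h => absurd hA h,
        fun _ => by rw [heq, finrank_fractionRing_tensorProduct], hsfr, hsfr'⟩
    · obtain ⟨⟨hA1, hA2⟩, hB1, hB2⟩ := fSignature_eq_zero_of_not_isDomain hA hF hinj hs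
      exact ⟨hA1, hB1, fun _ => ⟨hA2, hB2⟩, fun h => absurd h hA, hsfr, hsfr'⟩
  · intro k S H _ _ _ _ _ _ _ α _ _ _ hH hF hS hR hfin hα t ht ht0 hs hm
    have hinj : Function.Injective (algebraMap α.invariants S) := Subtype.val_injective
    -- the trace makes `F_* R` a quotient of the finite `R`-module `F_* S`
    have hFR : IsFFinite p α.invariants := hF.of_surjective hs
    by_cases hdom : IsDomain α.invariants
    · obtain ⟨hB, heq⟩ := fSignature_transformation_of_isDomain hFR hinj
        (α.freelyGeneratesDual_trace hS hR hα ht ht0 hs) hs hm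
      refine ⟨fSignatureExists_of_isDomain hFR, hB, ?_⟩
      rw [heq, α.finrank_eq_of_isTorsorInCodimOne hα]
    · obtain ⟨⟨hR1, hR2⟩, hS1, hS2⟩ := fSignature_eq_zero_of_not_isDomain hdom hFR hinj hs
      exact ⟨hR1, hS1, by rw [hR2, hS2, mul_zero, mul_zero]⟩
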